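/- **Setting.** We work in many-sorted first-order logic with equality, with countably infinitely many variables of each sort and with structures whose domains are non-empty and pairwise disjoint. A *datatypes signature* $\Sigma$ is a finite signature whose sorts are split into element sorts $\mathbf{Elem}$ and structure sorts $\mathbf{Struct}$; whose function symbols are *constructors* $c:\sigma_1\times\dots\times\sigma_n\to\sigma$ together with one *selector* $s_{c,i}:\sigma\to\sigma_i$ for each constructor $c$ and each $1\le i\le n$; and whose predicate symbols, besides equality, are one *tester* $is_c:\sigma$ for each constructor $c$. Moreover every structure sort must have at least one tree over the family of sets with exactly one element in each element sort; here, for a family $D=(D_\sigma)_{\sigma\in\mathbf{Elem}}$ of non-empty sets, a *tree over $D$* is a ground term built from the constructors and from the elements of $D$ used as constants. $\mathcal T_\Sigma$ is the class of all $\Sigma$-structures whose domains are, for some family $D$ of non-empty sets, the sets of trees over $D$ of each sort, in which constructors are interpreted as term formation, $is_c$ holds exactly of the trees $c(t_1,\dots,t_n)$, and $s_{c,i}(c(t_1,\dots,t_n))=t_i$ (the selector being arbitrary on other trees). $TREE_\Sigma$ is the class of $\Sigma$-structures satisfying the following axioms, universally quantified, for all constructors $c\ne d$ and all positions $i$: injectivity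 $c(\vec X)=c(\vec Y)\rightarrow\bigwedge_j X_j=Y_j$; distinctness $c(\vec X)\neq d(\vec Y)$; projection $s_{c,i}(c(\vec X))=X_i$; the tester axioms $is_c(c(\vec X))$ and $\neg is_c(d(\vec X))$; and acyclicity $X\neq t[X]$ for every non-variable term $t$ built from constructors and variables and containing the variable $X$. $TREE^*_\Sigma$ is the class of structures that satisfy in addition $\bigvee_{c:\sigma_1\times\dots\times\sigma_n\to\sigma} is_c(X)$ for every structure sort $\sigma$ ($X$ of sort $\sigma$) and $is_c(X)\rightarrow\exists\vec y.\,X=c(\vec y)$ for every constructor $c$. For a class $T$ of structures, a formula is *$T$-satisfiable* if it holds in some structure of $T$ under some interpretation of the variables, and two formulas are *$T$-equivalent* if they hold in the same structures of $T$ under the same interpretations of the variables. A *flat literal* is one of $x=y$, $x\neq y$, $x=f(x_1,\dots,x_n)$, $P(x_1,\dots,x_n)$, $\neg P(x_1,\dots,x_n)$ with variables $x,y,x_1,\dots,x_n$. An *arrangement* of a finite set $V$ of variables is the conjunction, for some family of equivalence relations $E_\sigma$ on the variables in $V$ of sort $\sigma$, of all $x=y$ with $(x,y)\in E_\sigma$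 and all $x\ne y$ with $x,y$ of sort $\sigma$ and $(x,y)\notin E_\sigma$. **Proposition.** Let $\Sigma$ be a datatypes signature and let $\varphi$ be a conjunction of flat $\Sigma$-literals that includes an arrangement of the set of all variables of $\varphi$. Then there is a quantifier-free $\Sigma$-formula $\varphi'$ such that, with $\vec w$ the set of variables that occur in $\varphi'$ but not in $\varphi$: 1. $\varphi$ and $\exists\vec w.\,\varphi'$ are $\mathcal T_\Sigma$-equivalent, and they are also $TREE^*_\Sigma$-equivalent; 2. $\varphi'$ is $\mathcal T_\Sigma$-satisfiable if and only if it is $TREE_\Sigma$-satisfiable. -/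

import Mathlib

universe u

namespace ADT

/-! # Many-sorted first-order logic with equality -/

/-- A many-sorted signature. The equality symbols are not listed among the predicate symbols `Pr`:
they are part of the logic. -/
structure Signature where
  Srt : Type
  Fn : Type
  Pr : Type
  fnArity : Fn → ℕ
  fnArg : (f : Fn) → Fin (fnArity f) → Srt
  fnRes : Fn → Srt
  prArity : Pr → ℕ
  prArg : (P : Pr) → Fin (prArity P) → Srt

/-- Sorted variables: countably many of each sort. -/
abbrev Signature.Var (Sg : Signature) : Type := Sg.Srt × ℕ

/-- Well-sorted terms. -/
inductive Term (Sg : Signature) : Sg.Srt → Type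
  | var (σ : Sg.Srt) (n : ℕ) : Term Sg σ
  | app (f : Sg.Fn) (ts : (i : Fin (Sg.fnArity f)) → Term Sg (Sg.fnArg f i)) :
      Term Sg (Sg.fnRes f)

/-- First-order formulas. -/
inductive Formula (Sg : Signature) : Type
  | fls : Formula Sg
  | eq {σ : Sg.Srt} (s t : Term Sg σ) : Formula Sg
  | rel (P : Sg.Pr) (ts : (i : Fin (Sg.prArity P)) → Term Sg (Sg.prArg P i)) : Formula Sg
  | neg (φ : Formula Sg) : Formula Sg
  | and (φ ψ : Formula Sg) : Formula Sg
  | or (φ ψ : Formula Sg) : Formula Sg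
  | imp (φ ψ : Formula Sg) : Formula Sg
  | all (x : Sg.Var) (φ : Formula Sg) : Formula Sg
  | ex (x : Sg.Var) (φ : Formula Sg) : Formula Sg

open Classical in
/-- The variables of a term. -/
noncomputable def Term.fv {Sg : Signature} : {σ : Sg.Srt} → Term Sg σ → Finset Sg.Var
  | _, .var σ n => {(σ, n)}
  | _, .app _ ts => Finset.univ.biUnion fun i => (ts i).fv

def Term.IsVar {Sg : Signature} : {σ : Sg.Srt} → Term Sg σ → Prop
  | _, .var _ _ => True
  | _, .app _ _ => False

open Classical in
/-- The free variables of a formula. -/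
noncomputable def Formula.fv {Sg : Signature} : Formula Sg → Finset Sg.Var
  | .fls => ∅
  | .eq s t => s.fv ∪ t.fv
  | .rel _ ts => Finset.univ.biUnion fun i => (ts i).fv
  | .neg φ => φ.fv
  | .and φ ψ => φ.fv ∪ ψ.fv
  | .or φ ψ => φ.fv ∪ ψ.fv
  | .imp φ ψ => φ.fv ∪ ψ.fv
  | .all x φ => φ.fv \ {x}
  | .ex x φ => φ.fv \ {x}

/-- Quantifier-free formulas. -/
def Formula.IsQF {Sg : Signature} : Formula Sg → Prop
  | .fls => True
  | .eq _ _ => True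
  | .rel _ _ => True
  | .neg φ => φ.IsQF
  | .and φ ψ => φ.IsQF ∧ ψ.IsQF
  | .or φ ψ => φ.IsQF ∧ ψ.IsQF
  | .imp φ ψ => φ.IsQF ∧ ψ.IsQF
  | .all _ _ => False
  | .ex _ _ => False

/-- The conjunction of a list of formulas; the empty conjunction is `⊤`, that is `¬ ⊥`. -/
def Formula.conj {Sg : Signature} : List (Formula Sg) → Formula Sg
  | [] => .neg .fls
  | φ :: L => .and φ (Formula.conj L)

/-- `∃ x₁ … xₙ. φ` -/
def Formula.exs {Sg : Signature} : List Sg.Var → Formula Sg → Formula Sg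
  | [], φ => φ
  | x :: w, φ => .ex x (Formula.exs w φ)

open Classical in
/-- The formula `∃ w. ψ`, where `w` is the set of variables that are free in `ψ` but not in `φ`. -/
noncomputable def Formula.exNew {Sg : Signature} (φ ψ : Formula Sg) : Formula Sg :=
  Formula.exs (ψ.fv \ φ.fv).toList ψ

/-- Flat literals: `x = y`, `x ≠ y`, `x = f(x₁, …, xₙ)`, `P(x₁, …, xₙ)`, `¬ P(x₁, …, xₙ)`
for variables `x, y, x₁, …, xₙ`. -/
inductive Formula.IsFlatLiteral {Sg : Signature} : Formula Sg → Prop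
  | eq (σ : Sg.Srt) (x y : ℕ) : Formula.IsFlatLiteral (.eq (.var σ x) (.var σ y))
  | ne (σ : Sg.Srt) (x y : ℕ) : Formula.IsFlatLiteral (.neg (.eq (.var σ x) (.var σ y)))
  | app (x : ℕ) (f : Sg.Fn) (xs : Fin (Sg.fnArity f) → ℕ) :
      Formula.IsFlatLiteral (.eq (.var (Sg.fnRes f) x) (.app f fun i => .var (Sg.fnArg f i) (xs i)))
  | rel (P : Sg.Pr) (xs : Fin (Sg.prArity P) → ℕ) :
      Formula.IsFlatLiteral (.rel P fun i => .var (Sg.prArg P i) (xs i))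
  | nrel (P : Sg.Pr) (xs : Fin (Sg.prArity P) → ℕ) :
      Formula.IsFlatLiteral (.neg (.rel P fun i => .var (Sg.prArg P i) (xs i)))

/-- The conjuncts of the arrangement of `V` given by a family of equivalence relations `E σ`, each
on the set of variables of sort `σ` in `V`: all `x = y` with `(x, y) ∈ E σ` and all `x ≠ y` with
`(x, y) ∉ E σ`. -/
def arrangement {Sg : Signature} (V : Finset Sg.Var)
    (E : (σ : Sg.Srt) → Setoid {n : ℕ // (σ, n) ∈ V}) : Set (Formula Sg) :=
  {l | ∃ (σ : Sg.Srt) (x y : {n : ℕ // (σ, n) ∈ V}),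
    ((E σ) x y ∧ l = .eq (.var σ x.1) (.var σ y.1)) ∨
    (¬ (E σ) x y ∧ l = .neg (.eq (.var σ x.1) (.var σ y.1)))}

/-- The conjunction of the literals in `L` includes an arrangement of its own variables. -/
def IncludesArrangement {Sg : Signature} (L : List (Formula Sg)) : Prop :=
  ∃ E : (σ : Sg.Srt) → Setoid {n : ℕ // (σ, n) ∈ (Formula.conj L).fv},
    ∀ l ∈ arrangement (Formula.conj L).fv E, l ∈ L

/-- Many-sorted structures, with non-empty domains. -/
structure Structure (Sg : Signature) where
  carrier : Sg.Srt → Type u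
  nonempty : ∀ σ, Nonempty (carrier σ)
  fn : (f : Sg.Fn) → ((i : Fin (Sg.fnArity f)) → carrier (Sg.fnArg f i)) → carrier (Sg.fnRes f)
  rel : (P : Sg.Pr) → ((i : Fin (Sg.prArity P)) → carrier (Sg.prArg P i)) → Prop

/-- An element of some domain, together with its sort (domains of distinct sorts are disjoint). -/
abbrev Structure.Elt {Sg : Signature} (A : Structure.{u} Sg) : Type u :=
  (σ : Sg.Srt) × A.carrier σ

/-- An interpretation of the variables. -/
abbrev Structure.Valuation {Sg : Signature} (A : Structure.{u} Sg) : Type u :=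
  (x : Sg.Var) → A.carrier x.1

def Term.eval {Sg : Signature} (A : Structure.{u} Sg) (v : A.Valuation) :
    {σ : Sg.Srt} → Term Sg σ → A.carrier σ
  | _, .var σ n => v (σ, n)
  | _, .app f ts => A.fn f fun i => (ts i).eval A v

open Classical in
/-- Satisfaction. -/
def Formula.Sat {Sg : Signature} (A : Structure.{u} Sg) : Formula Sg → A.Valuation → Prop
  | .fls, _ => False
  | .eq s t, v => s.eval A v = t.eval A v
  | .rel P ts, v => A.rel P fun i => (ts i).eval A v
  | .neg φ, v => ¬ φ.Sat A v
  | .and φ ψ, v => φ.Sat A v ∧ ψ.Sat A v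
  | .or φ ψ, v => φ.Sat A v ∨ ψ.Sat A v
  | .imp φ ψ, v => φ.Sat A v → ψ.Sat A v
  | .all x φ, v => ∀ a : A.carrier x.1, φ.Sat A (Function.update v x a)
  | .ex x φ, v => ∃ a : A.carrier x.1, φ.Sat A (Function.update v x a)

/-- A theory is a class of structures. -/
abbrev Theory (Sg : Signature) := Set (Structure.{u} Sg)

/-- `T`-satisfiability. -/
def Theory.Satisfiable {Sg : Signature} (T : Theory.{u} Sg) (φ : Formula Sg) : Prop :=
  ∃ A ∈ T, ∃ v : A.Valuation, φ.Sat A v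

/-- `T`-equivalence. -/
def Theory.Equivalent {Sg : Signature} (T : Theory.{u} Sg) (φ ψ : Formula Sg) : Prop :=
  ∀ A ∈ T, ∀ v : A.Valuation, φ.Sat A v ↔ ψ.Sat A v

/-! # Trees and datatypes signatures -/

/-- `Σ`-trees over an `S`-sorted set `A`, by sort, for a set `S` of sorts: ground terms built from
the function symbols and from the elements of `A` as constants. -/
inductive Tree (Sg : Signature) (S : Set Sg.Srt) (A : S → Type u) : Sg.Srt → Type u
  | atom {σ : Sg.Srt} (h : σ ∈ S) (a : A ⟨σ, h⟩) : Tree Sg S A σ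
  | node (f : Sg.Fn) (ts : (i : Fin (Sg.fnArity f)) → Tree Sg S A (Sg.fnArg f i)) :
      Tree Sg S A (Sg.fnRes f)

/-- Sorts, divided into element sorts `Elem` and structure sorts `Elemᶜ`, and constructors. -/
structure Constructors where
  Srt : Type
  Elem : Set Srt
  Con : Type
  arity : Con → ℕ
  arg : (c : Con) → Fin (arity c) → Srt
  res : Con → Srt

/-- The signature that has only the constructors. -/
abbrev Constructors.conSig (S : Constructors) : Signature where
  Srt := S.Srt
  Fn := S.Con
  Pr := Empty
  fnArity := S.arity
  fnArg := S.arg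
  fnRes := S.res
  prArity := fun P => P.elim
  prArg := fun P => P.elim

/-- Selectors: one for every constructor `c` and every argument position of `c`. -/
abbrev Constructors.Sel (S : Constructors) : Type := (c : S.Con) × Fin (S.arity c)

/-- The signature `Σ` with the constructors, the selectors `s_{c,i} : σ → σᵢ` and the testers
`is_c : σ`, for all constructors `c : σ₁ × … × σₙ → σ`. -/
abbrev Constructors.sig (S : Constructors) : Signature where
  Srt := S.Srt
  Fn := S.Con ⊕ S.Sel
  Pr := S.Con
  fnArity := Sum.elim S.arity fun _ => 1
  fnArg := fun f => match f with
    | .inl c => S.arg c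
    | .inr s => fun _ => S.res s.1
  fnRes := Sum.elim S.res fun s => S.arg s.1 s.2
  prArity := fun _ => 1
  prArg := fun c _ => S.res c

/-- Datatypes signatures: finite, and every structure sort has a tree over the `Elem`-sorted set
that has one element in each sort. -/
structure DatatypesSignature extends Constructors where
  finite_srt : Finite Srt
  finite_con : Finite Con
  wellFounded : ∀ σ, σ ∉ Elem →
    Nonempty (Tree toConstructors.conSig Elem (fun _ => Unit) σ)

/-! # The theory of datatypes -/

theorem Tree.nonempty_of {Sg : Signature} {S : Set Sg.Srt} (D : S → Type u)
    (hD : ∀ e, Nonempty (D e)) {σ : Sg.Srt} (t : Tree Sg S (fun _ => Unit) σ) :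
    Nonempty (Tree Sg S D σ) := by
  induction t with
  | atom h _ => exact (hD ⟨_, h⟩).map (Tree.atom h)
  | node f _ ih => exact ⟨.node f fun i => (ih i).some⟩

theorem DatatypesSignature.tree_nonempty (S : DatatypesSignature) (D : S.Elem → Type u)
    (hD : ∀ e, Nonempty (D e)) (σ : S.Srt) : Nonempty (Tree S.conSig S.Elem D σ) := by
  by_cases h : σ ∈ S.Elem
  · exact Tree.nonempty_of D hD (Tree.atom (Sg := S.conSig) h ())
  · obtain ⟨t⟩ := S.wellFounded σ h
    exact Tree.nonempty_of D hD t

/-- The structure of all trees over `D`, with selectors interpreted by `sel`. -/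
def DatatypesSignature.treeStructure (S : DatatypesSignature) (D : S.Elem → Type u)
    (hD : ∀ e, Nonempty (D e))
    (sel : (s : S.Sel) → Tree S.conSig S.Elem D (S.res s.1) →
      Tree S.conSig S.Elem D (S.arg s.1 s.2)) :
    Structure.{u} S.sig where
  carrier := Tree S.conSig S.Elem D
  nonempty := S.tree_nonempty D hD
  fn := fun f => match f with
    | .inl c => fun ts => Tree.node (Sg := S.conSig) c ts
    | .inr s => fun ts => sel s (ts (0 : Fin 1))
  rel := fun c ts => ∃ us : (i : Fin (S.arity c)) → Tree S.conSig S.Elem D (S.arg c i),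
    ts (0 : Fin 1) = Tree.node (Sg := S.conSig) c us

/-- The theory `T_Σ` of datatypes: the structures of trees over some `Elem`-sorted set, in which
`s_{c,i}(c(t₁, …, tₙ)) = tᵢ` and the selectors are arbitrary otherwise. -/
def DatatypesSignature.datatypes (S : DatatypesSignature) : Theory.{u} S.sig :=
  {A | ∃ (D : S.Elem → Type u) (hD : ∀ e, Nonempty (D e))
      (sel : (s : S.Sel) → Tree S.conSig S.Elem D (S.res s.1) →
        Tree S.conSig S.Elem D (S.arg s.1 s.2)),
      (∀ (c : S.Con) (ts : (i : Fin (S.arity c)) → Tree S.conSig S.Elem D (S.arg c i))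
        (i : Fin (S.arity c)), sel ⟨c, i⟩ (Tree.node (Sg := S.conSig) c ts) = ts i) ∧
      A = S.treeStructure D hD sel}

/-! # The axiomatized theories of trees -/

/-- The interpretation of a constructor. -/
abbrev DatatypesSignature.conFn (S : DatatypesSignature) (A : Structure.{u} S.sig) (c : S.Con)
    (xs : (i : Fin (S.arity c)) → A.carrier (S.arg c i)) : A.carrier (S.res c) :=
  A.fn (Sum.inl c) xs

/-- The interpretation of a selector. -/
abbrev DatatypesSignature.selFn (S : DatatypesSignature) (A : Structure.{u} S.sig) (c : S.Con)
    (i : Fin (S.arity c)) (x : A.carrier (S.res c)) : A.carrier (S.arg c i) :=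
  A.fn (Sum.inr ⟨c, i⟩) fun _ => x

/-- The interpretation of a tester. -/
abbrev DatatypesSignature.isCon (S : DatatypesSignature) (A : Structure.{u} S.sig) (c : S.Con)
    (x : A.carrier (S.res c)) : Prop :=
  A.rel c fun _ => x

/-- The restriction of a structure to the constructors. -/
def DatatypesSignature.conReduct (S : DatatypesSignature) (A : Structure.{u} S.sig) :
    Structure.{u} S.conSig where
  carrier := A.carrier
  nonempty := A.nonempty
  fn := S.conFn A
  rel := fun P => P.elim

/-- The axioms of `TREE_Σ`. -/
structure DatatypesSignature.IsTree (S : DatatypesSignature) (A : Structure.{u} S.sig) : Prop where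
  inj : ∀ (c : S.Con) (xs ys : (i : Fin (S.arity c)) → A.carrier (S.arg c i)),
    S.conFn A c xs = S.conFn A c ys → ∀ i, xs i = ys i
  dis : ∀ (c d : S.Con), c ≠ d → ∀ (xs : (i : Fin (S.arity c)) → A.carrier (S.arg c i))
    (ys : (i : Fin (S.arity d)) → A.carrier (S.arg d i)),
    (⟨S.res c, S.conFn A c xs⟩ : A.Elt) ≠ ⟨S.res d, S.conFn A d ys⟩
  proj : ∀ (c : S.Con) (i : Fin (S.arity c))
    (xs : (i : Fin (S.arity c)) → A.carrier (S.arg c i)), S.selFn A c i (S.conFn A c xs) = xs i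
  is₁ : ∀ (c : S.Con) (xs : (i : Fin (S.arity c)) → A.carrier (S.arg c i)),
    S.isCon A c (S.conFn A c xs)
  is₂ : ∀ (c d : S.Con), c ≠ d → ∀ (x : A.carrier (S.res c))
    (ys : (i : Fin (S.arity d)) → A.carrier (S.arg d i)),
    (⟨S.res c, x⟩ : A.Elt) = ⟨S.res d, S.conFn A d ys⟩ → ¬ S.isCon A c x
  acyc : ∀ (σ : S.Srt) (n : ℕ) (t : Term S.conSig σ), ¬ t.IsVar → (σ, n) ∈ t.fv →
    ∀ v : (S.conReduct A).Valuation, v (σ, n) ≠ t.eval (S.conReduct A) v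

/-- The axioms of `TREE*_Σ`. -/
structure DatatypesSignature.IsTreeStar (S : DatatypesSignature) (A : Structure.{u} S.sig) :
    Prop extends S.IsTree A where
  ext₁ : ∀ (σ : S.Srt), σ ∉ S.Elem → ∀ x : A.carrier σ,
    ∃ (c : S.Con) (y : A.carrier (S.res c)), (⟨S.res c, y⟩ : A.Elt) = ⟨σ, x⟩ ∧ S.isCon A c y
  ext₂ : ∀ (c : S.Con) (x : A.carrier (S.res c)), S.isCon A c x →
    ∃ ys : (i : Fin (S.arity c)) → A.carrier (S.arg c i), x = S.conFn A c ys

/-- The theory `TREE_Σ`. -/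
def DatatypesSignature.tree (S : DatatypesSignature) : Theory.{u} S.sig := {A | S.IsTree A}

/-- The theory `TREE*_Σ`. -/
def DatatypesSignature.treeStar (S : DatatypesSignature) : Theory.{u} S.sig := {A | S.IsTreeStar A}

end ADT

namespace ADT

/-! # Trees -/

namespace Tree

/-! Take φ' to be φ ∧ ψ, where ψ says that the value of each variable of φ can be unfolded N + 1
times by constructors, unless the unfolding reaches an element of an element sort at which no tester
holds (an irreducible element). Here N exceeds the heights of all trees of those sorts whose trees
have bounded height. In `TREE*` every element can be unfolded (`sat_unfoldFormula`), so ψ is valid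
there. Its variables are those of φ, so nothing is quantified. Structures of trees are models of
`TREE*`, which settles equivalence and one direction of satisfiability.

For the other direction, let φ ∧ ψ hold in a model A of `TREE`, and let X be the finite set of
values of the variables of φ. A may contain elements that are not built by constructors. Write each
element of X as a tree over A by unfolding it, stopping at irreducible elements and at elements
outside X whose sort has arbitrarily high trees (`IsTree.exists_rep`). Acyclicity makes the
recursion through X terminate. In a sort with trees of bounded height the unfolding must itself end
in irreducible elements, as otherwise it would yield a tree of height at least N.

Now keep the irreducible elements as atoms and replace the other atoms by trees whose heights lie
very far apart. By comparison of heights, distinct elements of X receive distinct trees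
(`Tree.bind_injective`). Uniqueness of the representation (`IsTree.isCut_unique`) makes the map
respect constructors. Selectors on trees that are not of the right constructor are free, so they can
be copied from A. -/

theorem sigma_node_inj {Sg : Signature} {S : Set Sg.Srt} {A : S → Type u} {f g : Sg.Fn}
    {xs : (i : Fin (Sg.fnArity f)) → Tree Sg S A (Sg.fnArg f i)}
    {ys : (i : Fin (Sg.fnArity g)) → Tree Sg S A (Sg.fnArg g i)}
    (h : (⟨_, node f xs⟩ : (σ : Sg.Srt) × Tree Sg S A σ) = ⟨_, node g ys⟩) :
    (⟨f, xs⟩ : (f : Sg.Fn) × ((i : Fin (Sg.fnArity f)) → Tree Sg S A (Sg.fnArg f i))) =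
      ⟨g, ys⟩ := by
  -- Case analysis on the equation would have to unify `Sg.fnRes f` with `Sg.fnRes g`; a function
  -- that reads off the root avoids this.
  let args : (σ : Sg.Srt) × Tree Sg S A σ →
      Option ((f : Sg.Fn) × ((i : Fin (Sg.fnArity f)) → Tree Sg S A (Sg.fnArg f i))) :=
    fun t => match t with
      | ⟨_, atom _ _⟩ => none
      | ⟨_, node f ts⟩ => some ⟨f, ts⟩
  exact Option.some.inj (congrArg args h)

theorem node_inj {Sg : Signature} {S : Set Sg.Srt} {A : S → Type u} {f : Sg.Fn}
    {xs ys : (i : Fin (Sg.fnArity f)) → Tree Sg S A (Sg.fnArg f i)}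
    (h : node f xs = node f ys) : xs = ys :=
  eq_of_heq (Sigma.mk.inj (sigma_node_inj (congrArg (Sigma.mk _) h))).2

theorem sigma_atom_ne_node {Sg : Signature} {S : Set Sg.Srt} {A : S → Type u} {f : Sg.Fn}
    {σ : Sg.Srt} {h : σ ∈ S} {a : A ⟨σ, h⟩}
    {ys : (i : Fin (Sg.fnArity f)) → Tree Sg S A (Sg.fnArg f i)} :
    (⟨σ, atom h a⟩ : (σ : Sg.Srt) × Tree Sg S A σ) ≠ ⟨_, node f ys⟩ := by
  intro h
  let isAtom : (σ : Sg.Srt) × Tree Sg S A σ → Prop :=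
    fun t => match t with
      | ⟨_, atom _ _⟩ => True
      | ⟨_, node _ _⟩ => False
  exact (congrArg isAtom h).mp trivial

/-- The height of a tree; atoms have height `0`. -/
def height {Sg : Signature} {S : Set Sg.Srt} {A : S → Type u} :
    {σ : Sg.Srt} → Tree Sg S A σ → ℕ
  | _, .atom _ _ => 0
  | _, .node _ ts => (Finset.univ.sup fun i => (ts i).height) + 1

theorem height_lt_node {Sg : Signature} {S : Set Sg.Srt} {A : S → Type u} {f : Sg.Fn}
    (ts : (i : Fin (Sg.fnArity f)) → Tree Sg S A (Sg.fnArg f i)) (i : Fin (Sg.fnArity f)) :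
    (ts i).height < (node f ts).height := by
  rw [height]
  exact Nat.lt_succ_of_le (Finset.le_sup (f := fun i => (ts i).height) (Finset.mem_univ i))

/-- The atoms of a tree. -/
def atoms {Sg : Signature} {S : Set Sg.Srt} {A : S → Type u} :
    {σ : Sg.Srt} → Tree Sg S A σ → Set ((s : S) × A s)
  | _, .atom h a => {⟨⟨_, h⟩, a⟩}
  | _, .node _ ts => ⋃ i, (ts i).atoms

theorem finite_atoms {Sg : Signature} {S : Set Sg.Srt} {A : S → Type u} {σ : Sg.Srt}
    (t : Tree Sg S A σ) : t.atoms.Finite := by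
  induction t with
  | atom h a => exact Set.finite_singleton _
  | node f ts ih => exact Set.finite_iUnion ih

/-- Substitution of trees for the atoms of a tree. -/
def bind {Sg : Signature} {S S' : Set Sg.Srt} {A : S → Type*} {A' : S' → Type u}
    (e : (a : (s : S) × A s) → Tree Sg S' A' a.1.1) :
    {σ : Sg.Srt} → Tree Sg S A σ → Tree Sg S' A' σ
  | _, .atom h a => e ⟨⟨_, h⟩, a⟩
  | _, .node f ts => .node f fun i => (ts i).bind e

theorem height_le_height_bind {Sg : Signature} {S S' : Set Sg.Srt} {A : S → Type*}
    {A' : S' → Type u} (e : (a : (s : S) × A s) → Tree Sg S' A' a.1.1) {σ : Sg.Srt}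
    (t : Tree Sg S A σ) : t.height ≤ (t.bind e).height := by
  induction t with
  | atom h a => exact Nat.zero_le _
  | node f ts ih =>
    rw [bind, height, height]
    exact Nat.succ_le_succ (Finset.sup_mono_fun fun i _ => ih i)

/-- The height of a tree after a substitution that keeps the atoms outside of a set `T` small: it is
determined by an atom in `T`, or not increased. -/
theorem height_bind_eq_or_le {Sg : Signature} {S S' : Set Sg.Srt} {A : S → Type*}
    {A' : S' → Type u} (e : (a : (s : S) × A s) → Tree Sg S' A' a.1.1) (T : Set ((s : S) × A s))
    (he : ∀ a, a ∉ T → (e a).height = 0) {σ : Sg.Srt} (t : Tree Sg S A σ) :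
    (∃ a ∈ t.atoms, a ∈ T ∧ ∃ k ≤ t.height, (t.height ≠ 0 → k ≠ 0) ∧
      (t.bind e).height = (e a).height + k) ∨ (t.bind e).height ≤ t.height := by
  induction t with
  | atom h a =>
    by_cases ha : (⟨⟨_, h⟩, a⟩ : (s : S) × A s) ∈ T
    · exact .inl ⟨_, rfl, ha, 0, le_rfl, fun h => (h rfl).elim, rfl⟩
    · exact .inr (he _ ha).le
  | node f ts ih =>
    -- A nullary root has height 1 before and after; otherwise an argument of maximal height after
    -- substitution decides the case.
    rcases isEmpty_or_nonempty (Fin (Sg.fnArity f)) with hf | hf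
    · right
      simp [bind, height]
    · obtain ⟨i, -, hi⟩ := Finset.exists_mem_eq_sup Finset.univ Finset.univ_nonempty
        fun i => ((ts i).bind e).height
      have hb : ((node f ts).bind e).height = ((ts i).bind e).height + 1 := by
        rw [bind, height, hi]
      have hlt := height_lt_node ts i
      rcases ih i with ⟨a, ha, haT, k, hk, -, hak⟩ | hle
      · exact .inl ⟨a, Set.mem_iUnion.2 ⟨i, ha⟩, haT, k + 1, by omega, fun _ => by omega, by omega⟩
      · exact .inr (by omega)

/-- A substitution is injective on the trees of height at most `M` if the trees that it substitutes
for the atoms in `T` have heights that are far apart from each other and from `0`. -/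
theorem bind_injective {Sg : Signature} {S S' : Set Sg.Srt} {A : S → Type*}
    {A' : S' → Type u} (e : (a : (s : S) × A s) → Tree Sg S' A' a.1.1)
    (T K : Set ((s : S) × A s)) (M : ℕ)
    (he : ∀ a, a ∉ T → ∃ h x, e a = .atom h x)
    (hinj : ∀ a b, a ∉ T → b ∉ T →
      (⟨_, e a⟩ : (σ : Sg.Srt) × Tree Sg S' A' σ) = ⟨_, e b⟩ → a = b)
    (hM : ∀ a ∈ K, a ∈ T → M < (e a).height)
    (hgap : ∀ a ∈ K, a ∈ T → ∀ b ∈ K, b ∈ T → a ≠ b →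
      (e a).height + M < (e b).height ∨ (e b).height + M < (e a).height)
    {σ τ : Sg.Srt} (s : Tree Sg S A σ) (t : Tree Sg S A τ)
    (hs : s.atoms ⊆ K) (ht : t.atoms ⊆ K) (hsM : s.height ≤ M) (htM : t.height ≤ M)
    (hst : (⟨_, s.bind e⟩ : (σ : Sg.Srt) × Tree Sg S' A' σ) = ⟨_, t.bind e⟩) :
    (⟨_, s⟩ : (σ : Sg.Srt) × Tree Sg S A σ) = ⟨_, t⟩ := by
  have he0 : ∀ a, a ∉ T → (e a).height = 0 := by
    intro a ha
    obtain ⟨h, x, hx⟩ := he a ha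
    rw [hx, height]
  have hht : ∀ {x y : (σ : Sg.Srt) × Tree Sg S' A' σ}, x = y → x.2.height = y.2.height := by
    rintro x _ rfl
    rfl
  have mixed : ∀ (f : Sg.Fn) (ts : (i : Fin (Sg.fnArity f)) → Tree Sg S A (Sg.fnArg f i))
      (a : (s : S) × A s), a ∈ K → (node f ts).atoms ⊆ K → (node f ts).height ≤ M →
      (⟨_, e a⟩ : (σ : Sg.Srt) × Tree Sg S' A' σ) ≠ ⟨_, (node f ts).bind e⟩ := by
    intro f ts a ha hts hM' h
    by_cases haT : a ∈ T
    · have h1 : (e a).height = ((node f ts).bind e).height := hht h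
      have h2 := hM a ha haT
      rcases height_bind_eq_or_le e T he0 (node f ts) with ⟨b, hb, hbT, k, hk, hk0, hbk⟩ | hle
      -- A proper offset 0 < k ≤ M rules out a = b, and the gap of more than M rules out a ≠ b.
      · have hk0 := hk0 (by rw [height]; omega)
        by_cases hab : a = b
        · subst hab
          omega
        · rcases hgap a ha haT b (hts hb) hbT hab with h | h <;> omega
      · omega
    · obtain ⟨h', x, hx⟩ := he a haT
      rw [hx, bind] at h
      exact sigma_atom_ne_node h
  induction s generalizing τ t with
  | @atom σ h a =>
    have haK : (⟨⟨σ, h⟩, a⟩ : (s : S) × A s) ∈ K := hs rfl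
    cases t with
    | atom h' b =>
      have hbK : (⟨⟨τ, h'⟩, b⟩ : (s : S) × A s) ∈ K := ht rfl
      have hab : (⟨⟨σ, h⟩, a⟩ : (s : S) × A s) = ⟨⟨τ, h'⟩, b⟩ := by
        have h1 : (e ⟨⟨σ, h⟩, a⟩).height = (e ⟨⟨τ, h'⟩, b⟩).height := hht hst
        by_cases haT : (⟨⟨σ, h⟩, a⟩ : (s : S) × A s) ∈ T <;>
          by_cases hbT : (⟨⟨τ, h'⟩, b⟩ : (s : S) × A s) ∈ T
        · by_contra hne
          rcases hgap _ haK haT _ hbK hbT hne with h | h <;> omega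
        · have h2 := hM _ haK haT
          have h3 := he0 _ hbT
          omega
        · have h2 := hM _ hbK hbT
          have h3 := he0 _ haT
          omega
        · exact hinj _ _ haT hbT hst
      cases hab
      rfl
    | node f ts => exact (mixed f ts _ haK ht htM hst).elim
  | node f ts ih =>
    cases t with
    | atom h' b => exact (mixed f ts _ (ht rfl) hs hsM hst.symm).elim
    | node g us =>
      rw [bind, bind] at hst
      have hfg := sigma_node_inj hst
      obtain rfl : f = g := congrArg Sigma.fst hfg
      have hargs := congrFun (eq_of_heq (Sigma.mk.inj hfg).2)
      obtain rfl : ts = us := by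
        funext i
        have hi := ih i (us i) ((Set.subset_iUnion _ i).trans hs)
          ((Set.subset_iUnion (fun i => (us i).atoms) i).trans ht)
          ((height_lt_node ts i).le.trans hsM) ((height_lt_node us i).le.trans htM)
          (congrArg (Sigma.mk _) (hargs i))
        exact eq_of_heq (Sigma.mk.inj hi).2
      rfl

/-- A choice of trees with heights that are far apart. -/
theorem exists_heights_apart {Sg : Signature} {S S' : Set Sg.Srt} {A : S → Type*}
    {A' : S' → Type u} (hne : ∀ σ, Nonempty (Tree Sg S' A' σ)) (M : ℕ)
    {T : Set ((s : S) × A s)} (hT : T.Finite)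
    (htall : ∀ a ∈ T, ∀ n, ∃ t : Tree Sg S' A' a.1.1, n ≤ t.height) :
    ∃ e : (a : (s : S) × A s) → Tree Sg S' A' a.1.1, (∀ a ∈ T, M < (e a).height) ∧
      ∀ a ∈ T, ∀ b ∈ T, a ≠ b →
        (e a).height + M < (e b).height ∨ (e b).height + M < (e a).height := by
  classical
  induction T, hT using Set.Finite.induction_on with
  | empty => exact ⟨fun a => (hne _).some, by simp, by simp⟩
  | @insert x T hx hT ih =>
    obtain ⟨e, heM, hgap⟩ := ih fun a ha => htall a (Set.mem_insert_of_mem _ ha)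
    -- The summand M + 1 gives both the gap to the earlier trees and a height above M itself.
    obtain ⟨t, ht⟩ := htall x (Set.mem_insert _ _)
      ((hT.toFinset.sup fun a => (e a).height) + M + 1)
    have hle : ∀ a ∈ T, (e a).height + M < t.height := by
      intro a ha
      have := Finset.le_sup (f := fun a => (e a).height) (hT.mem_toFinset.2 ha)
      omega
    have hold : ∀ a ∈ T, Function.update e x t a = e a := by
      intro a ha
      exact Function.update_of_ne (by rintro rfl; exact hx ha) _ _
    refine ⟨Function.update e x t, ?_, ?_⟩
    · rintro a (rfl | ha)
      · rw [Function.update_self]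
        omega
      · rw [hold a ha]
        exact heM a ha
    · rintro a (rfl | ha) b (rfl | hb) hab
      · exact (hab rfl).elim
      · rw [Function.update_self, hold b hb]
        exact .inr (hle b hb)
      · rw [Function.update_self, hold a ha]
        exact .inl (hle a ha)
      · rw [hold a ha, hold b hb]
        exact hgap a ha b hb hab

end Tree

/-! # Formulas -/

theorem Term.fv_app_subset {Sg : Signature} {f : Sg.Fn}
    {ts : (i : Fin (Sg.fnArity f)) → Term Sg (Sg.fnArg f i)} {V : Finset Sg.Var}
    (h : ∀ i, (ts i).fv ⊆ V) : (Term.app f ts).fv ⊆ V := by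
  classical
  rw [Term.fv]
  exact Finset.biUnion_subset.2 fun i _ => h i

namespace Formula

/-- The disjunction of a list of formulas. -/
def disj {Sg : Signature} : List (Formula Sg) → Formula Sg
  | [] => .fls
  | φ :: L => .or φ (disj L)

theorem isQF_conj {Sg : Signature} {L : List (Formula Sg)} (h : ∀ φ ∈ L, φ.IsQF) :
    (conj L).IsQF := by
  induction L with
  | nil => trivial
  | cons φ L ih => exact ⟨h φ (by simp), ih fun ψ hψ => h ψ (by simp [hψ])⟩

theorem isQF_disj {Sg : Signature} {L : List (Formula Sg)} (h : ∀ φ ∈ L, φ.IsQF) :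
    (disj L).IsQF := by
  induction L with
  | nil => trivial
  | cons φ L ih => exact ⟨h φ (by simp), ih fun ψ hψ => h ψ (by simp [hψ])⟩

theorem fv_conj_subset {Sg : Signature} {L : List (Formula Sg)} {V : Finset Sg.Var}
    (h : ∀ φ ∈ L, φ.fv ⊆ V) : (conj L).fv ⊆ V := by
  classical
  induction L with
  | nil => simp [conj, fv]
  | cons φ L ih =>
    exact Finset.union_subset (h φ (by simp)) (ih fun ψ hψ => h ψ (by simp [hψ]))

theorem fv_disj_subset {Sg : Signature} {L : List (Formula Sg)} {V : Finset Sg.Var}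
    (h : ∀ φ ∈ L, φ.fv ⊆ V) : (disj L).fv ⊆ V := by
  classical
  induction L with
  | nil => simp [disj, fv]
  | cons φ L ih =>
    exact Finset.union_subset (h φ (by simp)) (ih fun ψ hψ => h ψ (by simp [hψ]))

theorem fv_subset_fv_conj {Sg : Signature} {L : List (Formula Sg)} {φ : Formula Sg} (h : φ ∈ L) :
    φ.fv ⊆ (conj L).fv := by
  classical
  induction L with
  | nil => simp at h
  | cons ψ L ih =>
    rcases List.mem_cons.1 h with rfl | h
    · exact Finset.subset_union_left
    · exact (ih h).trans Finset.subset_union_right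

theorem sat_conj {Sg : Signature} {A : Structure.{u} Sg} {v : A.Valuation}
    {L : List (Formula Sg)} : (conj L).Sat A v ↔ ∀ φ ∈ L, φ.Sat A v := by
  induction L with
  | nil => simp [conj, Sat]
  | cons φ L ih => simp [conj, Sat, ih]

theorem sat_disj {Sg : Signature} {A : Structure.{u} Sg} {v : A.Valuation}
    {L : List (Formula Sg)} : (disj L).Sat A v ↔ ∃ φ ∈ L, φ.Sat A v := by
  induction L with
  | nil => simp [disj, Sat]
  | cons φ L ih => simp [disj, Sat, ih]

theorem exNew_eq_self {Sg : Signature} {φ ψ : Formula Sg} (h : ψ.fv ⊆ φ.fv) :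
    exNew φ ψ = ψ := by
  classical
  rw [exNew, Finset.sdiff_eq_empty_iff_subset.2 h, Finset.toList_empty, exs]

theorem IsFlatLiteral.isQF {Sg : Signature} {φ : Formula Sg} (h : φ.IsFlatLiteral) : φ.IsQF := by
  cases h <;> trivial

end Formula

namespace DatatypesSignature

instance (S : DatatypesSignature) : Finite S.Srt := S.finite_srt

instance (S : DatatypesSignature) : Finite S.Con := S.finite_con

/-! # Unfolding of elements -/

/-- A list of all constructors. -/
noncomputable def cons (S : DatatypesSignature) : List S.Con :=
  (@Finset.univ S.Con (Fintype.ofFinite _)).toList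

theorem mem_cons (S : DatatypesSignature) (c : S.Con) : c ∈ S.cons := by
  simp [cons]

/-- The term `s_{c,i}(t)`. -/
def selTerm (S : DatatypesSignature) (c : S.Con) (i : Fin (S.arity c))
    (t : Term S.sig (S.res c)) : Term S.sig (S.arg c i) :=
  Term.app (Sg := S.sig) (.inr ⟨c, i⟩) fun _ => t

/-- The term `c(s_{c,1}(t), …, s_{c,n}(t))`. -/
def rebuild (S : DatatypesSignature) (c : S.Con) (t : Term S.sig (S.res c)) :
    Term S.sig (S.res c) :=
  Term.app (Sg := S.sig) (.inl c) fun i => S.selTerm c i t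

/-- The formula that says that `t` is an element of an element sort in which no tester holds. -/
noncomputable def irreducibleFormula (S : DatatypesSignature) (σ : S.Srt)
    (t : Term S.sig σ) : Formula S.sig :=
  open Classical in
  -- Only element sorts have atoms in a structure of trees, so an element of a structure sort must
  -- not count as irreducible.
  if σ ∈ S.Elem then
    .conj (S.cons.map fun c =>
      if h : S.res c = σ then .neg (.rel (Sg := S.sig) c fun _ => (h ▸ t : Term S.sig (S.res c))) else .neg .fls)
  else .fls

/-- The formula that says that `t` can be unfolded to depth `k`: it is irreducible or
`t = c(s_{c,1}(t), …, s_{c,n}(t))` for some constructor `c`, and likewise to depth `k - 1` for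
the `s_{c,i}(t)`. -/
noncomputable def unfoldFormula (S : DatatypesSignature) :
    ℕ → (σ : S.Srt) → Term S.sig σ → Formula S.sig
  | 0, _, _ => .neg .fls
  | k + 1, σ, t =>
    open Classical in
    .or
      (.disj (S.cons.map fun c =>
        if h : S.res c = σ then
          .and (.eq (h ▸ t) (S.rebuild c (h ▸ t)))
            (.conj (List.ofFn fun i => S.unfoldFormula k _ (S.selTerm c i (h ▸ t))))
        else .fls))
      (S.irreducibleFormula σ t)

theorem isQF_irreducibleFormula (S : DatatypesSignature) (σ : S.Srt) (t : Term S.sig σ) :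
    (S.irreducibleFormula σ t).IsQF := by
  rw [irreducibleFormula]
  split
  · refine Formula.isQF_conj fun φ hφ => ?_
    obtain ⟨c, -, rfl⟩ := List.mem_map.1 hφ
    split <;> trivial
  · trivial

theorem isQF_unfoldFormula (S : DatatypesSignature) (k : ℕ) (σ : S.Srt) (t : Term S.sig σ) :
    (S.unfoldFormula k σ t).IsQF := by
  induction k generalizing σ with
  | zero => trivial
  | succ k ih =>
    refine ⟨Formula.isQF_disj fun φ hφ => ?_, S.isQF_irreducibleFormula σ t⟩
    obtain ⟨c, -, rfl⟩ := List.mem_map.1 hφ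
    split
    · refine ⟨trivial, Formula.isQF_conj fun φ hφ => ?_⟩
      obtain ⟨i, rfl⟩ := (List.mem_ofFn' _ _).1 hφ
      exact ih _ _
    · trivial

theorem fv_selTerm (S : DatatypesSignature) (c : S.Con) (i : Fin (S.arity c))
    (t : Term S.sig (S.res c)) : (S.selTerm c i t).fv ⊆ t.fv :=
  Term.fv_app_subset fun _ => Finset.Subset.refl _

theorem fv_rebuild (S : DatatypesSignature) (c : S.Con) (t : Term S.sig (S.res c)) :
    (S.rebuild c t).fv ⊆ t.fv :=
  Term.fv_app_subset fun i => S.fv_selTerm c i t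

theorem fv_irreducibleFormula (S : DatatypesSignature) (σ : S.Srt) (t : Term S.sig σ) :
    (S.irreducibleFormula σ t).fv ⊆ t.fv := by
  classical
  rw [irreducibleFormula]
  split
  · refine Formula.fv_conj_subset fun φ hφ => ?_
    obtain ⟨c, -, rfl⟩ := List.mem_map.1 hφ
    split
    · rename_i h
      subst h
      exact Finset.biUnion_subset.2 fun _ _ => Finset.Subset.refl _
    · exact Finset.empty_subset _
  · exact Finset.empty_subset _

theorem fv_unfoldFormula (S : DatatypesSignature) (k : ℕ) (σ : S.Srt) (t : Term S.sig σ) :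
    (S.unfoldFormula k σ t).fv ⊆ t.fv := by
  classical
  induction k generalizing σ with
  | zero => exact Finset.empty_subset _
  | succ k ih =>
    refine Finset.union_subset (Formula.fv_disj_subset fun φ hφ => ?_)
      (S.fv_irreducibleFormula σ t)
    obtain ⟨c, -, rfl⟩ := List.mem_map.1 hφ
    split
    · rename_i h
      subst h
      refine Finset.union_subset (Finset.union_subset (Finset.Subset.refl _) (S.fv_rebuild c t))
        (Formula.fv_conj_subset fun φ hφ => ?_)
      obtain ⟨i, rfl⟩ := (List.mem_ofFn' _ _).1 hφ
      exact (ih _ _).trans (S.fv_selTerm c i t)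
    · exact Finset.empty_subset _

/-- An element of an element sort in which no tester holds. -/
def Irreducible (S : DatatypesSignature) (A : Structure.{u} S.sig) (σ : S.Srt)
    (a : A.carrier σ) : Prop :=
  σ ∈ S.Elem ∧ ∀ (c : S.Con) (y : A.carrier (S.res c)), (⟨_, y⟩ : A.Elt) = ⟨σ, a⟩ → ¬ S.isCon A c y

/-- An element that can be unfolded to depth `k`: it is irreducible or `c(y₁, …, yₙ)` for some
constructor `c` and some `y₁, …, yₙ` that can be unfolded to depth `k - 1`. -/
def Unfolds (S : DatatypesSignature) (A : Structure.{u} S.sig) :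
    ℕ → (σ : S.Srt) → A.carrier σ → Prop
  | 0, _, _ => True
  | k + 1, σ, a =>
    (∃ (c : S.Con) (ys : (i : Fin (S.arity c)) → A.carrier (S.arg c i)),
      (⟨_, S.conFn A c ys⟩ : A.Elt) = ⟨σ, a⟩ ∧ ∀ i, S.Unfolds A k _ (ys i)) ∨
    S.Irreducible A σ a

theorem sat_irreducibleFormula (S : DatatypesSignature) {A : Structure.{u} S.sig}
    {v : A.Valuation} {σ : S.Srt} {t : Term S.sig σ} :
    (S.irreducibleFormula σ t).Sat A v ↔ S.Irreducible A σ (t.eval A v) := by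
  rw [irreducibleFormula, Irreducible]
  split
  · rename_i hσ
    rw [Formula.sat_conj]
    refine ⟨fun h => ⟨hσ, fun c y hy => ?_⟩, fun h φ hφ => ?_⟩
    · obtain rfl : S.res c = σ := congrArg Sigma.fst hy
      have := h _ (List.mem_map.2 ⟨c, S.mem_cons c, rfl⟩)
      rw [dif_pos rfl] at this
      rw [eq_of_heq (Sigma.mk.inj hy).2]
      exact this
    · obtain ⟨c, -, rfl⟩ := List.mem_map.1 hφ
      split
      · rename_i hc
        subst hc
        exact h.2 c _ rfl
      · exact id
  · rename_i hσ
    exact ⟨False.elim, fun h => (hσ h.1).elim⟩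

theorem unfolds_of_sat (S : DatatypesSignature) {A : Structure.{u} S.sig} {v : A.Valuation}
    {k : ℕ} {σ : S.Srt} {t : Term S.sig σ} (h : (S.unfoldFormula k σ t).Sat A v) :
    S.Unfolds A k σ (t.eval A v) := by
  induction k generalizing σ with
  | zero => trivial
  | succ k ih =>
    rcases h with h | h
    · obtain ⟨φ, hφ, h⟩ := Formula.sat_disj.1 h
      obtain ⟨c, -, rfl⟩ := List.mem_map.1 hφ
      split at h
      · rename_i hc
        subst hc
        refine .inl ⟨c, fun i => (S.selTerm c i t).eval A v, congrArg (Sigma.mk _) h.1.symm,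
          fun i => ih ?_⟩
        exact Formula.sat_conj.1 h.2 _ ((List.mem_ofFn' _ _).2 ⟨i, rfl⟩)
      · exact h.elim
    · exact .inr (S.sat_irreducibleFormula.1 h)

/-- An element that is not irreducible satisfies some tester, by the first extensionality axiom in
structure sorts and by definition in element sorts. The second axiom makes it a constructor term,
and projection identifies its arguments with the selector values. -/
theorem sat_unfoldFormula (S : DatatypesSignature) {A : Structure.{u} S.sig}
    (hA : S.IsTreeStar A) (v : A.Valuation) (k : ℕ) {σ : S.Srt} (t : Term S.sig σ) :
    (S.unfoldFormula k σ t).Sat A v := by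
  induction k generalizing σ with
  | zero => exact id
  | succ k ih =>
    by_cases hirr : S.Irreducible A σ (t.eval A v)
    · exact .inr (S.sat_irreducibleFormula.2 hirr)
    · have hc : ∃ (c : S.Con) (y : A.carrier (S.res c)),
          (⟨_, y⟩ : A.Elt) = ⟨σ, t.eval A v⟩ ∧ S.isCon A c y := by
        by_cases hσ : σ ∈ S.Elem
        · by_contra! hc
          exact hirr ⟨hσ, hc⟩
        · exact hA.ext₁ σ hσ _
      obtain ⟨c, y, hy, hcy⟩ := hc
      obtain rfl : S.res c = σ := congrArg Sigma.fst hy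
      obtain rfl := eq_of_heq (Sigma.mk.inj hy).2
      refine .inl (Formula.sat_disj.2 ⟨_, List.mem_map.2 ⟨c, S.mem_cons c, rfl⟩, ?_⟩)
      rw [dif_pos rfl]
      refine ⟨?_, Formula.sat_conj.2 fun φ hφ => ?_⟩
      · obtain ⟨ys, hys⟩ := hA.ext₂ c _ hcy
        change t.eval A v = S.conFn A c fun i => S.selFn A c i (t.eval A v)
        rw [hys]
        exact congrArg _ (funext fun i => (hA.proj c i ys).symm)
      · obtain ⟨i, rfl⟩ := (List.mem_ofFn' _ _).1 hφ
        exact ih _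

/-! # The structures of trees are models of the axioms -/

theorem isTreeStar_treeStructure (S : DatatypesSignature) (D : S.Elem → Type u)
    (hD : ∀ e, Nonempty (D e))
    (sel : (s : S.Sel) → Tree S.conSig S.Elem D (S.res s.1) →
      Tree S.conSig S.Elem D (S.arg s.1 s.2))
    (hsel : ∀ (c : S.Con) (ts : (i : Fin (S.arity c)) → Tree S.conSig S.Elem D (S.arg c i))
        (i : Fin (S.arity c)), sel ⟨c, i⟩ (Tree.node (Sg := S.conSig) c ts) = ts i) :
    S.IsTreeStar (S.treeStructure D hD sel) where
  inj c xs ys h i := congrFun (Tree.node_inj (Sg := S.conSig) h) i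
  dis c d hcd xs ys h := hcd (congrArg Sigma.fst (Tree.sigma_node_inj (Sg := S.conSig) h))
  proj c i xs := hsel c xs i
  is₁ c xs := ⟨xs, rfl⟩
  is₂ c d hcd x ys h := by
    rintro ⟨us, hus⟩
    change x = _ at hus
    subst hus
    exact hcd (congrArg Sigma.fst (Tree.sigma_node_inj (Sg := S.conSig) h))
  acyc σ n t ht hn v h := by
    classical
    -- Acyclicity follows from height, which grows strictly from a variable to any proper
    -- constructor term around it.
    have key : ∀ {τ : S.conSig.Srt} (t : Term S.conSig τ), (σ, n) ∈ t.fv →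
        Tree.height (Sg := S.conSig) (v (σ, n)) ≤ Tree.height (Sg := S.conSig) (t.eval _ v) ∧
        (¬ t.IsVar →
          Tree.height (Sg := S.conSig) (v (σ, n)) < Tree.height (Sg := S.conSig) (t.eval _ v)) := by
      intro τ t hn
      induction t with
      | var τ m =>
        rw [Term.fv, Finset.mem_singleton] at hn
        cases hn
        exact ⟨le_rfl, fun h => (h trivial).elim⟩
      | app f ts ih =>
        rw [Term.fv] at hn
        obtain ⟨i, -, hi⟩ := Finset.mem_biUnion.1 hn
        have h1 := (ih i hi).1.trans_lt
          (Tree.height_lt_node (Sg := S.conSig) (f := f) (fun i => (ts i).eval _ v) i)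
        exact ⟨h1.le, fun _ => h1⟩
    have := (key t hn).2 ht
    rw [h] at this
    exact lt_irrefl _ this
  ext₁ σ hσ x := by
    have key : ∀ (τ : S.conSig.Srt) (x : Tree S.conSig S.Elem D τ), τ ∉ S.Elem →
        ∃ c ts, (⟨_, Tree.node (Sg := S.conSig) c ts⟩ :
          (τ : S.conSig.Srt) × Tree S.conSig S.Elem D τ) = ⟨τ, x⟩ := by
      intro τ x hτ
      cases x with
      | atom h a => exact (hτ h).elim
      | node c ts => exact ⟨c, ts, rfl⟩
    obtain ⟨c, ts, h⟩ := key σ x hσ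
    exact ⟨c, _, h, ts, rfl⟩
  ext₂ c x h := h

theorem datatypes_subset_treeStar (S : DatatypesSignature) :
    (S.datatypes : Theory.{u} S.sig) ⊆ S.treeStar := by
  rintro A ⟨D, hD, sel, hsel, rfl⟩
  exact S.isTreeStar_treeStructure D hD sel hsel

theorem treeStar_subset_tree (S : DatatypesSignature) :
    (S.treeStar : Theory.{u} S.sig) ⊆ S.tree :=
  fun _ hA => hA.toIsTree

end DatatypesSignature

/-! ### Shape of trees of varying sort -/

namespace Tree

theorem sigma_cases {Sg : Signature} {S : Set Sg.Srt} {A : S → Type u}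
    (p : (σ : Sg.Srt) × Tree Sg S A σ) :
    (∃ σ h a, p = ⟨σ, atom h a⟩) ∨ ∃ f ts, p = ⟨_, node f ts⟩ := by
  obtain ⟨_, t⟩ := p
  cases t with
  | atom h a => exact .inl ⟨_, h, a, rfl⟩
  | node f ts => exact .inr ⟨f, ts, rfl⟩

theorem sigma_atom_inj {Sg : Signature} {S : Set Sg.Srt} {A : S → Type u} {σ τ : Sg.Srt}
    {h : σ ∈ S} {h' : τ ∈ S} {a : A ⟨σ, h⟩} {b : A ⟨τ, h'⟩}
    (hab : (⟨_, atom h a⟩ : (σ : Sg.Srt) × Tree Sg S A σ) = ⟨_, atom h' b⟩) :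
    (⟨⟨σ, h⟩, a⟩ : (s : S) × A s) = ⟨⟨τ, h'⟩, b⟩ := by
  have := congrArg (fun p : (σ : Sg.Srt) × Tree Sg S A σ => p.2.atoms) hab
  exact Set.singleton_injective this

end Tree

theorem Term.eval_congr {Sg : Signature} {A : Structure.{u} Sg} {v w : A.Valuation} {σ : Sg.Srt}
    {t : Term Sg σ} (h : ∀ x ∈ t.fv, v x = w x) : t.eval A v = t.eval A w := by
  classical
  induction t with
  | var σ n => exact h _ (by simp [fv])
  | app f ts ih =>
    rw [eval, eval]
    congr 1
    funext i
    refine ih i fun x hx => h x ?_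
    rw [fv]
    exact Finset.mem_biUnion.2 ⟨i, Finset.mem_univ i, hx⟩

namespace DatatypesSignature

/-! # Sorts with trees of unbounded height -/

/-- A sort with trees of unbounded height. -/
def TallSort (S : DatatypesSignature) (σ : S.Srt) : Prop :=
  ∀ n, ∃ t : Tree S.conSig S.Elem (fun _ => Unit) σ, n ≤ t.height

/-- A tree over a single-element family in which one argument of the root is given. -/
theorem exists_height_lt_of_arg (S : DatatypesSignature) {c : S.Con} {i : Fin (S.arity c)}
    (t : Tree S.conSig S.Elem (fun _ => Unit) (S.arg c i)) :
    ∃ t' : Tree S.conSig S.Elem (fun _ => Unit) (S.res c), t.height < t'.height := by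
  classical
  have hne := S.tree_nonempty (fun _ => Unit) fun _ => ⟨()⟩
  let ts : (j : Fin (S.arity c)) → Tree S.conSig S.Elem (fun _ => Unit) (S.arg c j) :=
    Function.update (fun j => (hne (S.arg c j)).some) i t
  refine ⟨Tree.node (Sg := S.conSig) c ts, ?_⟩
  have h := Tree.height_lt_node (Sg := S.conSig) (f := c) ts i
  have hi : ts i = t := Function.update_self ..
  rwa [hi] at h

theorem TallSort.of_arg {S : DatatypesSignature} {c : S.Con} {i : Fin (S.arity c)}
    (h : S.TallSort (S.arg c i)) : S.TallSort (S.res c) := by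
  intro n
  obtain ⟨t, ht⟩ := h n
  obtain ⟨t', ht'⟩ := S.exists_height_lt_of_arg t
  exact ⟨t', ht.trans ht'.le⟩

/-- There are finitely many sorts, so the individual bounds have a common one. -/
theorem exists_height_bound (S : DatatypesSignature) :
    ∃ N : ℕ, ∀ σ, ¬ S.TallSort σ →
      ∀ t : Tree S.conSig S.Elem (fun _ => Unit) σ, t.height < N := by
  have h : ∀ σ, ∃ N : ℕ, ¬ S.TallSort σ →
      ∀ t : Tree S.conSig S.Elem (fun _ => Unit) σ, t.height < N := by
    intro σ
    by_cases hσ : S.TallSort σ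
    · exact ⟨0, fun h => (h hσ).elim⟩
    · rw [TallSort] at hσ
      push Not at hσ
      obtain ⟨N, hN⟩ := hσ
      exact ⟨N, fun _ => hN⟩
  choose N hN using h
  obtain ⟨M, hM⟩ := (Set.finite_range N).bddAbove
  exact ⟨M, fun σ hσ t => (hN σ hσ t).trans_le (hM ⟨σ, rfl⟩)⟩

theorem TallSort.exists_tree {S : DatatypesSignature} {σ : S.Srt} (h : S.TallSort σ)
    (D : S.Elem → Type u) (hD : ∀ e, Nonempty (D e)) (n : ℕ) :
    ∃ t : Tree S.conSig S.Elem D σ, n ≤ t.height := by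
  obtain ⟨t, ht⟩ := h n
  exact ⟨t.bind fun a => .atom a.1.2 (hD a.1).some, ht.trans (Tree.height_le_height_bind _ t)⟩

/-! # Acyclicity -/

/-- The relation between a constructor term and its arguments. -/
def Child (S : DatatypesSignature) (A : Structure.{u} S.sig) (b a : A.Elt) : Prop :=
  ∃ (c : S.Con) (ys : (i : Fin (S.arity c)) → A.carrier (S.arg c i)) (i : Fin (S.arity c)),
    a = ⟨_, S.conFn A c ys⟩ ∧ b = ⟨_, ys i⟩

/-- `a` is the value of a constructor term in which a variable with value `b` occurs. -/
def IsContext (S : DatatypesSignature) (A : Structure.{u} S.sig) (b a : A.Elt)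
    (t : Term S.conSig a.1) : Prop :=
  ∃ (v : (S.conReduct A).Valuation) (n : ℕ),
    (b.1, n) ∈ t.fv ∧ v (b.1, n) = b.2 ∧ t.eval (S.conReduct A) v = a.2

/-- Put the term under the constructor, with fresh variables for the sibling arguments. This turns a
path of children into a single term to which the acyclicity axiom applies. -/
theorem exists_isContext_of_child (S : DatatypesSignature) {A : Structure.{u} S.sig}
    {b a' a : A.Elt} {t : Term S.conSig a'.1} (ht : S.IsContext A b a' t)
    (h : S.Child A a' a) : ∃ t', S.IsContext A b a t' ∧ ¬ t'.IsVar := by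
  classical
  obtain ⟨c, ys, i, rfl, rfl⟩ := h
  obtain ⟨v, n, hn, hvn, hv⟩ := ht
  obtain ⟨M, hM⟩ : ∃ M, ∀ x ∈ t.fv, x.2 < M :=
    ⟨t.fv.sup (fun x => x.2) + 1, fun x hx =>
      Nat.lt_succ_of_le (Finset.le_sup (f := fun x : S.conSig.Var => x.2) hx)⟩
  obtain ⟨w, hwv, hw⟩ : ∃ w : (S.conReduct A).Valuation, (∀ x, x.2 < M → w x = v x) ∧
      ∀ j : Fin (S.arity c), w (S.arg c j, M + j) = ys j := by
    -- The sibling at position j is named by the variable of index M + j, which is beyond all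
    -- indices in t and distinct for distinct j.
    let P : (x : S.conSig.Var) → A.carrier x.1 → Prop := fun x a =>
      ∃ j : Fin (S.arity c), (⟨x.1, a⟩ : A.Elt) = ⟨_, ys j⟩ ∧ x.2 = M + j
    refine ⟨fun x => if h : ∃ a, P x a then h.choose else v x, fun x hx => ?_, fun j => ?_⟩
    · refine dif_neg ?_
      rintro ⟨a, j, -, hj⟩
      omega
    · have hex : ∃ a, P (S.arg c j, M + j) a := ⟨ys j, j, rfl, rfl⟩
      refine (dif_pos hex).trans ?_
      obtain ⟨k, hk, hjk⟩ := hex.choose_spec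
      obtain rfl : j = k := Fin.ext (by simpa using hjk)
      exact eq_of_heq (Sigma.mk.inj hk).2
  let ts : (j : Fin (S.arity c)) → Term S.conSig (S.arg c j) :=
    Function.update (fun j => Term.var (Sg := S.conSig) (S.arg c j) (M + j)) i t
  have hti : ts i = t := Function.update_self ..
  refine ⟨Term.app (Sg := S.conSig) c ts, ⟨w, n, ?_, ?_, ?_⟩, id⟩
  · rw [Term.fv]
    exact Finset.mem_biUnion.2 ⟨i, Finset.mem_univ _, by rwa [hti]⟩
  · rw [hwv _ (hM _ hn), hvn]
  · rw [Term.eval]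
    change S.conFn A c _ = S.conFn A c _
    congr 1
    funext j
    by_cases hj : j = i
    · subst hj
      change Term.eval _ w (ts j) = _
      rw [hti, Term.eval_congr fun x hx => hwv x (hM x hx)]
      exact hv
    · have : ts j = Term.var (Sg := S.conSig) (S.arg c j) (M + j) := Function.update_of_ne hj _ _
      change Term.eval _ w (ts j) = _
      rw [this]
      exact hw j

theorem exists_isContext (S : DatatypesSignature) {A : Structure.{u} S.sig} {b a : A.Elt}
    (h : Relation.ReflTransGen (S.Child A) b a) : ∃ t, S.IsContext A b a t := by
  classical
  induction h with
  | refl =>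
    let v : (S.conReduct A).Valuation := fun x =>
      if hx : b.1 = x.1 then hx ▸ b.2 else (A.nonempty x.1).some
    exact ⟨Term.var (Sg := S.conSig) b.1 0, v, 0, by simp [Term.fv], dif_pos rfl, dif_pos rfl⟩
  | tail _ h ih =>
    obtain ⟨t, ht⟩ := ih
    obtain ⟨t', ht', -⟩ := S.exists_isContext_of_child ht h
    exact ⟨t', ht'⟩

theorem IsTree.not_transGen_child {S : DatatypesSignature} {A : Structure.{u} S.sig}
    (hA : S.IsTree A) (a : A.Elt) : ¬ Relation.TransGen (S.Child A) a a := by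
  intro h
  obtain ⟨b, hab, hba⟩ := Relation.TransGen.tail'_iff.1 h
  obtain ⟨t, ht⟩ := S.exists_isContext hab
  obtain ⟨t', ⟨v, n, hn, hvn, hv⟩, hvar⟩ := S.exists_isContext_of_child ht hba
  exact hA.acyc a.1 n t' hvar hn v (hvn.trans hv.symm)

/-- Acyclicity does not exclude infinite descent in A, so well-foundedness is only claimed on finite
sets. The transitive closure is taken in A, since a path between elements of X may leave X. -/
theorem IsTree.wellFounded_child {S : DatatypesSignature} {A : Structure.{u} S.sig}
    (hA : S.IsTree A) {X : Set A.Elt} (hX : X.Finite) :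
    WellFounded fun b a : X => Relation.TransGen (S.Child A) b.1 a.1 := by
  have := hX.to_subtype
  have : IsTrans X fun b a => Relation.TransGen (S.Child A) b.1 a.1 :=
    ⟨fun _ _ _ => Relation.TransGen.trans⟩
  have : Std.Irrefl fun b a : X => Relation.TransGen (S.Child A) b.1 a.1 :=
    ⟨fun a => hA.not_transGen_child a.1⟩
  exact Finite.wellFounded_of_trans_of_irrefl _

theorem IsTree.sigma_conFn_inj {S : DatatypesSignature} {A : Structure.{u} S.sig}
    (hA : S.IsTree A) {c d : S.Con} {xs : (i : Fin (S.arity c)) → A.carrier (S.arg c i)}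
    {ys : (i : Fin (S.arity d)) → A.carrier (S.arg d i)}
    (h : (⟨_, S.conFn A c xs⟩ : A.Elt) = ⟨_, S.conFn A d ys⟩) :
    (⟨c, xs⟩ : (c : S.Con) × ((i : Fin (S.arity c)) → A.carrier (S.arg c i))) = ⟨d, ys⟩ := by
  obtain rfl : c = d := by
    by_contra hcd
    exact hA.dis c d hcd xs ys h
  rw [funext (hA.inj c xs ys (eq_of_heq (Sigma.mk.inj h).2))]

theorem IsTree.not_irreducible_conFn {S : DatatypesSignature} {A : Structure.{u} S.sig}
    (hA : S.IsTree A) {c : S.Con} (xs : (i : Fin (S.arity c)) → A.carrier (S.arg c i)) :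
    ¬ S.Irreducible A _ (S.conFn A c xs) :=
  fun h => h.2 c _ rfl (hA.is₁ c xs)

/-! # Representation of elements by trees -/

/-- Trees over the elements of a structure. -/
abbrev Rep (S : DatatypesSignature) (A : Structure.{u} S.sig) (σ : S.Srt) : Type u :=
  Tree S.conSig Set.univ (fun s => A.carrier s.1) σ

/-- The value of a tree over the elements of a structure. -/
def Rep.value {S : DatatypesSignature} {A : Structure.{u} S.sig} {σ : S.conSig.Srt}
    (t : S.Rep A σ) : A.carrier σ :=
  match t with
  | .atom _ a => a
  | .node c ts => S.conFn A c fun i => Rep.value (ts i)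

/-- A tree whose atoms are irreducible or in `F`, with no value of another subtree in `F`. -/
def Rep.IsCut {S : DatatypesSignature} {A : Structure.{u} S.sig} (F : Set A.Elt)
    {σ : S.conSig.Srt} (t : S.Rep A σ) : Prop :=
  match t with
  | .atom _ a => (⟨_, a⟩ : A.Elt) ∈ F ∨ S.Irreducible A _ a
  | .node c ts => (⟨_, S.conFn A c fun i => Rep.value (ts i)⟩ : A.Elt) ∉ F ∧
      ∀ i, Rep.IsCut F (ts i)

theorem Rep.IsCut.atoms {S : DatatypesSignature} {A : Structure.{u} S.sig} {F : Set A.Elt}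
    {σ : S.conSig.Srt} {t : S.Rep A σ} (ht : Rep.IsCut F t) :
    ∀ a ∈ t.atoms, (⟨a.1.1, a.2⟩ : A.Elt) ∈ F ∨ S.Irreducible A a.1.1 a.2 := by
  induction t with
  | atom h a =>
    rintro _ rfl
    exact ht
  | node c ts ih =>
    intro a ha
    obtain ⟨i, hi⟩ := Set.mem_iUnion.1 ha
    exact ih i (ht.2 i) a hi

/-- The value alone decides whether to stop: constructor values are never irreducible, and
membership in F forces a cut. Below a node, distinctness and injectivity determine the constructor
and the arguments. -/
theorem IsTree.isCut_unique {S : DatatypesSignature} {A : Structure.{u} S.sig}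
    (hA : S.IsTree A) {F : Set A.Elt} {σ τ : S.conSig.Srt} {s : S.Rep A σ} {t : S.Rep A τ}
    (hs : Rep.IsCut F s) (ht : Rep.IsCut F t)
    (hst : (⟨_, Rep.value s⟩ : A.Elt) = ⟨_, Rep.value t⟩) :
    (⟨_, s⟩ : (σ : S.conSig.Srt) × S.Rep A σ) = ⟨_, t⟩ := by
  have mixed : ∀ (τ : S.Srt) (a : A.carrier τ) (c : S.Con)
      (ys : (i : Fin (S.arity c)) → A.carrier (S.arg c i)),
      (⟨_, S.conFn A c ys⟩ : A.Elt) ∉ F →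
      ((⟨τ, a⟩ : A.Elt) ∈ F ∨ S.Irreducible A τ a) →
      (⟨τ, a⟩ : A.Elt) ≠ ⟨_, S.conFn A c ys⟩ := by
    rintro τ a c ys h1 h2 h
    cases h
    exact h2.elim h1 (hA.not_irreducible_conFn ys)
  induction s generalizing τ t with
  | atom h a =>
    cases t with
    | atom h' b =>
      cases hst
      rfl
    | node d us => exact (mixed _ a d _ ht.1 hs hst).elim
  | node c ts ih =>
    cases t with
    | atom h' b => exact (mixed _ b c _ hs.1 ht hst.symm).elim
    | node d us =>
      have hcd := hA.sigma_conFn_inj hst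
      obtain rfl : c = d := congrArg Sigma.fst hcd
      have hargs := congrFun (eq_of_heq (Sigma.mk.inj hcd).2)
      obtain rfl : ts = us := by
        funext i
        have hi := ih i (hs.2 i) (ht.2 i) (congrArg (Sigma.mk _) (hargs i))
        exact eq_of_heq (Sigma.mk.inj hi).2
      rfl

/-- An element that unfolds to depth `k` is represented by a tree with irreducible atoms unless
its sort has a tree of height at least `k`. -/
theorem Unfolds.exists_rep_or_exists_height {S : DatatypesSignature} {A : Structure.{u} S.sig}
    {k : ℕ} {σ : S.Srt} {a : A.carrier σ} (h : S.Unfolds A k σ a) :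
    (∃ t : S.Rep A σ, Rep.value t = a ∧ Rep.IsCut ∅ t) ∨
      ∃ t : Tree S.conSig S.Elem (fun _ => Unit) σ, k ≤ t.height := by
  induction k generalizing σ with
  | zero => exact .inr ⟨(S.tree_nonempty _ (fun _ => ⟨()⟩) σ).some, Nat.zero_le _⟩
  | succ k ih =>
    rcases h with ⟨c, ys, hc, hys⟩ | h
    · cases hc
      by_cases hall : ∀ i, ∃ t : S.Rep A (S.arg c i), Rep.value t = ys i ∧ Rep.IsCut ∅ t
      · choose ts hts hcut using hall
        refine .inl ⟨Tree.node (Sg := S.conSig) c ts, ?_, fun h => h, hcut⟩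
        exact congrArg (S.conFn A c) (funext hts)
      -- An argument without a representation has a sort with a tree of height at least k; placing
      -- that tree under c gains one level.
      · obtain ⟨i, hi⟩ := not_forall.1 hall
        obtain ⟨t, ht⟩ := (ih (hys i)).resolve_left hi
        obtain ⟨t', ht'⟩ := S.exists_height_lt_of_arg t
        exact .inr ⟨t', ht.trans_lt ht'⟩
    · exact .inl ⟨.atom (Sg := S.conSig) trivial a, rfl, .inr h⟩

/-- All subtrees have sorts with trees of bounded height as well, so none of their values lies in F.
-/
theorem Rep.IsCut.of_not_tallSort {S : DatatypesSignature} {A : Structure.{u} S.sig}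
    {F : Set A.Elt} (hF : ∀ a ∈ F, S.TallSort a.1) {σ : S.conSig.Srt} {t : S.Rep A σ}
    (ht : Rep.IsCut ∅ t) (hσ : ¬ S.TallSort σ) : Rep.IsCut F t := by
  induction t with
  | atom h a => exact .inr (ht.resolve_left fun h => h)
  | node c ts ih =>
    exact ⟨fun h => hσ (hF _ h), fun i => ih i (ht.2 i) fun h => hσ (TallSort.of_arg h)⟩

/-- The elements of a finite set `X` of sufficiently unfoldable elements are represented by trees
that are cut at the elements outside of `X` of the sorts with trees of unbounded height. -/
theorem IsTree.exists_rep {S : DatatypesSignature} {A : Structure.{u} S.sig} (hA : S.IsTree A)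
    {N : ℕ} (hN : ∀ σ, ¬ S.TallSort σ →
      ∀ t : Tree S.conSig S.Elem (fun _ => Unit) σ, t.height < N)
    {X : Set A.Elt} (hX : X.Finite) (hunf : ∀ a ∈ X, S.Unfolds A (N + 1) a.1 a.2)
    (a : A.Elt) (ha : a ∈ X) :
    ∃ t : S.Rep A a.1, Rep.value t = a.2 ∧ Rep.IsCut {b | b ∉ X ∧ S.TallSort b.1} t := by
  suffices h : ∀ a : X, ∃ t : S.Rep A a.1.1, Rep.value t = a.1.2 ∧
      Rep.IsCut {b | b ∉ X ∧ S.TallSort b.1} t from h ⟨a, ha⟩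
  intro a
  induction a using (hA.wellFounded_child hX).induction with
  | _ a ih =>
    obtain ⟨⟨σ, a⟩, ha⟩ := a
    rcases hunf _ ha with ⟨c, ys, hc, hys⟩ | h
    · cases hc
      have hall : ∀ i, ∃ t : S.Rep A (S.arg c i), Rep.value t = ys i ∧
          Rep.IsCut {b | b ∉ X ∧ S.TallSort b.1} t := by
        intro i
        by_cases htall : S.TallSort (S.arg c i)
        · by_cases hi : (⟨_, ys i⟩ : A.Elt) ∈ X
          -- Elements of X are never cut, so the tree of one contains the tree of another that is
          -- its argument.
          · exact ih ⟨_, hi⟩ (.single ⟨c, ys, i, rfl, rfl⟩)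
          · exact ⟨.atom (Sg := S.conSig) trivial (ys i), rfl, .inl ⟨hi, htall⟩⟩
        -- Unfolding to depth N + 1 leaves depth N for the arguments, which already contradicts the
        -- strict bound N.
        · rcases (hys i).exists_rep_or_exists_height with ⟨t, ht, hcut⟩ | ⟨t, ht⟩
          · exact ⟨t, ht, hcut.of_not_tallSort (fun a ha => ha.2) htall⟩
          · exact ((hN _ htall t).not_ge ht).elim
      choose ts hts hcut using hall
      have hval : (fun i => Rep.value (ts i)) = ys := funext hts
      refine ⟨Tree.node (Sg := S.conSig) c ts, congrArg (S.conFn A c) hval, ?_, hcut⟩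
      rw [hval]
      exact fun h => h.1 ha
    · exact ⟨.atom (Sg := S.conSig) trivial a, rfl, .inr h⟩

/-! # From models of `TREE_Σ` to structures of trees -/

/-- The interpretation of the elements of a finite set `X` of sufficiently unfoldable elements by
trees: an injection that respects constructors and testers. -/
theorem IsTree.exists_embedding {S : DatatypesSignature} {A : Structure.{u} S.sig}
    (hA : S.IsTree A) {N : ℕ} (hN : ∀ σ, ¬ S.TallSort σ →
      ∀ t : Tree S.conSig S.Elem (fun _ => Unit) σ, t.height < N)
    {X : Set A.Elt} (hX : X.Finite) (hunf : ∀ a ∈ X, S.Unfolds A (N + 1) a.1 a.2) :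
    ∃ h : (a : A.Elt) → Tree S.conSig S.Elem (fun s => A.carrier s.1) a.1,
      (∀ σ (a b : A.carrier σ), ⟨σ, a⟩ ∈ X → ⟨σ, b⟩ ∈ X → h ⟨σ, a⟩ = h ⟨σ, b⟩ → a = b) ∧
      (∀ (c : S.Con) (a : A.carrier (S.res c)), ⟨_, a⟩ ∈ X → S.isCon A c a →
        ∃ us, h ⟨_, a⟩ = Tree.node (Sg := S.conSig) c us) ∧
      ∀ (c : S.Con) (a : A.carrier (S.res c)), ⟨_, a⟩ ∈ X →
        ∀ us, h ⟨_, a⟩ = Tree.node (Sg := S.conSig) c us →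
        ∃ ys, a = S.conFn A c ys ∧ ∀ i, (⟨_, ys i⟩ : A.Elt) ∈ X → us i = h ⟨_, ys i⟩ := by
  classical
  set F : Set A.Elt := {b | b ∉ X ∧ S.TallSort b.1} with hF
  have hrep : ∀ a : A.Elt, ∃ t : S.Rep A a.1, a ∈ X → Rep.value t = a.2 ∧ Rep.IsCut F t := by
    intro a
    by_cases ha : a ∈ X
    · obtain ⟨t, ht⟩ := hA.exists_rep hN hX hunf a ha
      exact ⟨t, fun _ => ht⟩
    · exact ⟨.atom (Sg := S.conSig) trivial a.2, fun h => (ha h).elim⟩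
  choose rep hrep using hrep
  let Atom : Type u := (s : (Set.univ : Set S.Srt)) × A.carrier s.1
  let K : Set Atom := ⋃ a ∈ X, (rep a).atoms
  let T : Set Atom := {a | ¬ S.Irreducible A a.1.1 a.2}
  have hK : K.Finite := hX.biUnion fun a _ => (rep a).finite_atoms
  have hKT : ∀ a ∈ K, a ∈ T → (⟨a.1.1, a.2⟩ : A.Elt) ∈ F := by
    intro a ha haT
    obtain ⟨x, hx, hax⟩ := Set.mem_iUnion₂.1 ha
    exact ((hrep x hx).2.atoms a hax).resolve_right haT
  obtain ⟨M, hM⟩ := (hX.image fun a => (rep a).height).bddAbove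
  have hD : ∀ s : S.Elem, Nonempty (A.carrier s.1) := fun s => A.nonempty s.1
  obtain ⟨e₀, he₀M, he₀gap⟩ := Tree.exists_heights_apart (Sg := S.conSig) (S := Set.univ)
    (A := fun s => A.carrier s.1) (S.tree_nonempty (fun s => A.carrier s.1) hD) M
    (hK.inter_of_left T)
    fun a ha n => TallSort.exists_tree (hKT a ha.1 ha.2).2 (fun s => A.carrier s.1) hD n
  let e : (a : Atom) → Tree S.conSig S.Elem (fun s => A.carrier s.1) a.1.1 := fun a =>
    if h : S.Irreducible A a.1.1 a.2 then .atom (Sg := S.conSig) h.1 a.2 else e₀ a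
  have he : ∀ a, a ∉ T → ∃ h, e a = .atom (Sg := S.conSig) h a.2 := by
    intro a ha
    have ha : S.Irreducible A a.1.1 a.2 := not_not.1 ha
    exact ⟨ha.1, dif_pos ha⟩
  have heT : ∀ a, a ∈ T → e a = e₀ a := fun a ha => dif_neg ha
  have hatom : ∀ a ∈ X, ∀ σ h (x : A.carrier σ),
      (⟨_, rep a⟩ : (σ : S.conSig.Srt) × S.Rep A σ) = ⟨σ, .atom (Sg := S.conSig) h x⟩ →
      a = ⟨σ, x⟩ ∧ ∃ h : σ ∈ S.Elem, S.Irreducible A σ x ∧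
        (⟨_, (rep a).bind e⟩ :
          (σ : S.conSig.Srt) × Tree S.conSig S.Elem (fun s => A.carrier s.1) σ) =
          ⟨σ, .atom (Sg := S.conSig) h x⟩ := by
    intro a ha σ h x hax
    have hval : (⟨_, Rep.value (rep a)⟩ : A.Elt) = ⟨σ, x⟩ :=
      congrArg (fun p : (σ : S.conSig.Srt) × S.Rep A σ => (⟨p.1, Rep.value p.2⟩ : A.Elt)) hax
    rw [(hrep a ha).1] at hval
    have hax' : a = ⟨σ, x⟩ := hval
    have hcut : (⟨σ, x⟩ : A.Elt) ∈ F ∨ S.Irreducible A σ x :=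
      cast (congrArg (fun p : (σ : S.conSig.Srt) × S.Rep A σ => Rep.IsCut F p.2) hax)
        (hrep a ha).2
    have hirr := hcut.resolve_left fun h => h.1 (hax' ▸ ha)
    obtain ⟨h', he'⟩ := he ⟨⟨σ, h⟩, x⟩ (not_not.2 hirr)
    refine ⟨hax', h', hirr, ?_⟩
    refine (congrArg (fun p : (σ : S.conSig.Srt) × S.Rep A σ =>
      (⟨p.1, p.2.bind e⟩ : (σ : S.conSig.Srt) × Tree S.conSig S.Elem _ σ)) hax).trans ?_
    exact congrArg (Sigma.mk _) he'
  have hnode : ∀ a ∈ X, ∀ (c : S.Con) (ts : (i : Fin (S.arity c)) → S.Rep A (S.arg c i)),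
      (⟨_, rep a⟩ : (σ : S.conSig.Srt) × S.Rep A σ) = ⟨_, .node (Sg := S.conSig) c ts⟩ →
      a = ⟨_, S.conFn A c fun i => Rep.value (ts i)⟩ ∧ (∀ i, Rep.IsCut F (ts i)) ∧
        (⟨_, (rep a).bind e⟩ :
          (σ : S.conSig.Srt) × Tree S.conSig S.Elem (fun s => A.carrier s.1) σ) =
          ⟨_, .node (Sg := S.conSig) c fun i => (ts i).bind e⟩ := by
    intro a ha c ts hats
    have hval : (⟨_, Rep.value (rep a)⟩ : A.Elt) = ⟨_, S.conFn A c fun i => Rep.value (ts i)⟩ :=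
      congrArg (fun p : (σ : S.conSig.Srt) × S.Rep A σ => (⟨p.1, Rep.value p.2⟩ : A.Elt)) hats
    rw [(hrep a ha).1] at hval
    have hcut : Rep.IsCut F (Tree.node (Sg := S.conSig) c ts) :=
      cast (congrArg (fun p : (σ : S.conSig.Srt) × S.Rep A σ => Rep.IsCut F p.2) hats)
        (hrep a ha).2
    refine ⟨hval, hcut.2, ?_⟩
    exact congrArg (fun p : (σ : S.conSig.Srt) × S.Rep A σ =>
      (⟨p.1, p.2.bind e⟩ : (σ : S.conSig.Srt) × Tree S.conSig S.Elem _ σ)) hats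
  refine ⟨fun a => (rep a).bind e, ?_, ?_, ?_⟩
  · intro σ a b ha hb hab
    have hsub : ∀ x ∈ X, (rep x).atoms ⊆ K := fun x hx =>
      Set.subset_biUnion_of_mem (u := fun a => (rep a).atoms) hx
    have hle : ∀ x ∈ X, (rep x).height ≤ M := fun x hx => hM (Set.mem_image_of_mem _ hx)
    have hreps := Tree.bind_injective (Sg := S.conSig) e T K M
      (fun a ha => (he a ha).imp fun h hx => ⟨a.2, hx⟩)
      (fun a b ha hb hab => by
        obtain ⟨h, hx⟩ := he a ha
        obtain ⟨h', hx'⟩ := he b hb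
        rw [hx, hx'] at hab
        obtain ⟨⟨σ, hσ⟩, a⟩ := a
        obtain ⟨⟨τ, hτ⟩, b⟩ := b
        cases Tree.sigma_atom_inj (Sg := S.conSig) (A := fun s : S.Elem => A.carrier s.1) hab
        rfl)
      (fun a ha haT => by
        rw [heT a haT]
        exact he₀M a ⟨ha, haT⟩)
      (fun a ha haT b hb hbT hab => by
        rw [heT a haT, heT b hbT]
        exact he₀gap a ⟨ha, haT⟩ b ⟨hb, hbT⟩ hab)
      (rep ⟨σ, a⟩) (rep ⟨σ, b⟩) (hsub _ ha) (hsub _ hb) (hle _ ha) (hle _ hb)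
      (congrArg (Sigma.mk _) hab)
    have h1 := (hrep _ ha).1
    have h2 := (hrep _ hb).1
    dsimp only at h1 h2
    rw [← h1, ← h2, eq_of_heq (Sigma.mk.inj hreps).2]
  · intro c a ha hca
    rcases Tree.sigma_cases (Sg := S.conSig) ⟨_, rep ⟨_, a⟩⟩ with ⟨σ, h, x, hx⟩ | ⟨d, ts, hd⟩
    · obtain ⟨hax, -, hirr, -⟩ := hatom _ ha σ h x hx
      exact (hirr.2 c a hax hca).elim
    · obtain ⟨had, -, hbind⟩ := hnode _ ha d ts hd
      -- A tester may hold at a wrong element in a model of `TREE`, but not at a term of another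
      -- constructor.
      obtain rfl : c = d := by
        by_contra hcd
        exact hA.is₂ c d hcd a _ had hca
      exact ⟨_, eq_of_heq (Sigma.mk.inj hbind).2⟩
  · intro c a ha us hus
    rcases Tree.sigma_cases (Sg := S.conSig) ⟨_, rep ⟨_, a⟩⟩ with ⟨σ, h, x, hx⟩ | ⟨d, ts, hd⟩
    · obtain ⟨-, _, -, hbind⟩ := hatom _ ha σ h x hx
      exact (Tree.sigma_atom_ne_node (Sg := S.conSig)
        (hbind.symm.trans (congrArg (Sigma.mk _) hus))).elim
    · obtain ⟨had, hcut, hbind⟩ := hnode _ ha d ts hd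
      have hdc := Tree.sigma_node_inj (Sg := S.conSig)
        (hbind.symm.trans (congrArg (Sigma.mk _) hus))
      obtain rfl : d = c := congrArg Sigma.fst hdc
      have hargs := congrFun (eq_of_heq (Sigma.mk.inj hdc).2)
      refine ⟨_, eq_of_heq (Sigma.mk.inj had).2, fun i hi => ?_⟩
      -- The subtree at position i and the chosen tree of that argument are both cut at F with the
      -- same value, hence equal.
      have hu := hA.isCut_unique (hrep _ hi).2 (hcut i) (congrArg (Sigma.mk _) (hrep _ hi).1)
      rw [← hargs i]
      exact (congrArg (Tree.bind e) (eq_of_heq (Sigma.mk.inj hu).2)).symm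

/-- Flat literals that hold in a model of `TREE_Σ` hold in a structure of trees if the values of
their variables are sufficiently unfoldable. -/
theorem IsTree.satisfiable_datatypes {S : DatatypesSignature} {A : Structure.{u} S.sig}
    (hA : S.IsTree A) {N : ℕ} (hN : ∀ σ, ¬ S.TallSort σ →
      ∀ t : Tree S.conSig S.Elem (fun _ => Unit) σ, t.height < N)
    (v : A.Valuation) (L : List (Formula S.sig)) (hL : ∀ l ∈ L, l.IsFlatLiteral)
    (hsat : ∀ l ∈ L, l.Sat A v)
    (hunf : ∀ x ∈ (Formula.conj L).fv, S.Unfolds A (N + 1) x.1 (v x)) :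
    (S.datatypes : Theory.{u} S.sig).Satisfiable (Formula.conj L) := by
  classical
  let elt : S.sig.Var → A.Elt := fun x => ⟨x.1, v x⟩
  set X : Set A.Elt := elt '' (Formula.conj L).fv with hXdef
  have hX : X.Finite := (Finset.finite_toSet _).image _
  obtain ⟨h, hinj, hcon, hargs⟩ := hA.exists_embedding hN hX (by
    rintro _ ⟨x, hx, rfl⟩
    exact hunf x hx)
  have hD : ∀ s : S.Elem, Nonempty (A.carrier s.1) := fun s => A.nonempty s.1
  let D : S.Elem → Type u := fun s => A.carrier s.1
  -- Projection fixes the selector on trees with root c. On other images of elements of X it copies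
  -- the selector of A, which is unambiguous because `h` is injective on X. Elsewhere the value is
  -- arbitrary.
  let sel : (s : S.Sel) → Tree S.conSig S.Elem D (S.res s.1) →
      Tree S.conSig S.Elem D (S.arg s.1 s.2) := fun s t =>
    if ht : ∃ us, t = Tree.node (Sg := S.conSig) s.1 us then ht.choose s.2
    else if ht : ∃ a : A.carrier (S.res s.1), ⟨_, a⟩ ∈ X ∧ h ⟨_, a⟩ = t then
      h ⟨_, S.selFn A s.1 s.2 ht.choose⟩
    else (S.tree_nonempty D hD _).some
  have hsel : ∀ (c : S.Con) (ts : (i : Fin (S.arity c)) → Tree S.conSig S.Elem D (S.arg c i))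
      (i : Fin (S.arity c)), sel ⟨c, i⟩ (Tree.node (Sg := S.conSig) c ts) = ts i := by
    intro c ts i
    have hex : ∃ us, Tree.node (Sg := S.conSig) c ts = Tree.node (Sg := S.conSig) c us := ⟨ts, rfl⟩
    refine (dif_pos hex).trans ?_
    exact (congrFun (Tree.node_inj (Sg := S.conSig) hex.choose_spec) i).symm
  have hsel' : ∀ (c : S.Con) (i : Fin (S.arity c)) (a : A.carrier (S.res c)), ⟨_, a⟩ ∈ X →
      (⟨_, S.selFn A c i a⟩ : A.Elt) ∈ X →
      sel ⟨c, i⟩ (h ⟨_, a⟩) = h ⟨_, S.selFn A c i a⟩ := by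
    intro c i a ha hi
    by_cases hnode : ∃ us, h ⟨_, a⟩ = Tree.node (Sg := S.conSig) c us
    · obtain ⟨us, hus⟩ := hnode
      -- A root c in the image comes from a term of c in A, so projection governs both sides.
      obtain ⟨ys, rfl, hys⟩ := hargs c a ha us hus
      rw [hA.proj] at hi ⊢
      rw [hus, hsel, hys i hi]
    · have hex : ∃ b : A.carrier (S.res c), ⟨_, b⟩ ∈ X ∧ h ⟨_, b⟩ = h ⟨_, a⟩ := ⟨a, ha, rfl⟩
      have hab := hinj _ _ _ hex.choose_spec.1 ha hex.choose_spec.2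
      refine (dif_neg hnode).trans ((dif_pos hex).trans ?_)
      rw [hab]
  have hcon' : ∀ (c : S.Con) (a : A.carrier (S.res c))
      (xs : (i : Fin (S.arity c)) → A.carrier (S.arg c i)), ⟨_, a⟩ ∈ X →
      (∀ i, (⟨_, xs i⟩ : A.Elt) ∈ X) → a = S.conFn A c xs →
      h ⟨_, a⟩ = Tree.node (Sg := S.conSig) c fun i => h ⟨_, xs i⟩ := by
    rintro c _ xs ha hxs rfl
    obtain ⟨us, hus⟩ := hcon c _ ha (hA.is₁ c _)
    obtain ⟨ys, hys, husys⟩ := hargs c _ ha us hus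
    obtain rfl : xs = ys := funext (hA.inj c _ _ hys)
    rw [hus, funext fun i => husys i (hxs i)]
  let w : (S.treeStructure D hD sel).Valuation := fun x => h ⟨x.1, v x⟩
  refine ⟨S.treeStructure D hD sel, ⟨D, hD, sel, hsel, rfl⟩, w, Formula.sat_conj.2 fun l hl => ?_⟩
  have hmem : ∀ x ∈ l.fv, (⟨x.1, v x⟩ : A.Elt) ∈ X := fun x hx =>
    Set.mem_image_of_mem elt (Formula.fv_subset_fv_conj hl hx)
  have hsatl := hsat l hl
  cases hL l hl with
  | eq σ x y =>
    have hxy : v (σ, x) = v (σ, y) := hsatl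
    change h ⟨σ, v (σ, x)⟩ = h ⟨σ, v (σ, y)⟩
    rw [hxy]
  | ne σ x y =>
    intro hxy
    exact hsatl (hinj σ _ _ (hmem (σ, x) (by simp [Formula.fv, Term.fv]))
      (hmem (σ, y) (by simp [Formula.fv, Term.fv])) hxy)
  | app x f xs =>
    have hx := hmem (S.sig.fnRes f, x) (Finset.mem_union_left _ (Finset.mem_singleton_self _))
    have hxs : ∀ i, (⟨_, v (S.sig.fnArg f i, xs i)⟩ : A.Elt) ∈ X := fun i => by
      refine hmem (S.sig.fnArg f i, xs i) (Finset.mem_union_right _ ?_)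
      rw [Term.fv]
      exact Finset.mem_biUnion.2 ⟨i, Finset.mem_univ i, Finset.mem_singleton_self _⟩
    rcases f with c | ⟨c, i⟩
    · exact hcon' c _ _ hx hxs hsatl
    · let y : Fin 1 → ℕ := xs
      have hy : (fun j : Fin 1 => v (S.res c, y j)) = fun _ => v (S.res c, y 0) :=
        funext fun j => by rw [Subsingleton.elim j 0]
      have hval : v (S.arg c i, x) = S.selFn A c i (v (S.res c, y 0)) :=
        (show v (S.arg c i, x) = A.fn (Sum.inr ⟨c, i⟩) fun j : Fin 1 => v (S.res c, y j)
          from hsatl).trans (congrArg (A.fn (Sum.inr ⟨c, i⟩)) hy)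
      change h ⟨S.arg c i, v (S.arg c i, x)⟩ = sel ⟨c, i⟩ (h ⟨_, v (S.res c, y 0)⟩)
      have hx' : (⟨S.arg c i, v (S.arg c i, x)⟩ : A.Elt) ∈ X := hx
      rw [hval] at hx' ⊢
      exact (hsel' c i _ (hxs (0 : Fin 1)) hx').symm
  | rel c xs =>
    let y : Fin 1 → ℕ := xs
    have hy : (fun j : Fin 1 => v (S.res c, y j)) = fun _ => v (S.res c, y 0) :=
      funext fun j => by rw [Subsingleton.elim j 0]
    have hval : S.isCon A c (v (S.res c, y 0)) := (congrArg (A.rel c) hy).mp hsatl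
    exact hcon c _ (hmem (S.res c, y 0) (Finset.mem_biUnion.2
      ⟨(0 : Fin 1), Finset.mem_univ _, Finset.mem_singleton_self _⟩)) hval
  | nrel c xs =>
    let y : Fin 1 → ℕ := xs
    have hy : (fun j : Fin 1 => v (S.res c, y j)) = fun _ => v (S.res c, y 0) :=
      funext fun j => by rw [Subsingleton.elim j 0]
    have hval : ¬ S.isCon A c (v (S.res c, y 0)) := fun h => hsatl ((congrArg (A.rel c) hy).mpr h)
    rintro ⟨us, hus⟩
    obtain ⟨ys, hys, -⟩ := hargs c _ (hmem (S.res c, y 0) (Finset.mem_biUnion.2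
      ⟨(0 : Fin 1), Finset.mem_univ _, Finset.mem_singleton_self _⟩)) us hus
    rw [hys] at hval
    exact hval (hA.is₁ c ys)

end DatatypesSignature

end ADT

/-! ### The formula φ' and the proposition -/

theorem proposition3 (S : ADT.DatatypesSignature) (L : List (ADT.Formula S.sig))
    (hflat : ∀ l ∈ L, l.IsFlatLiteral) (harr : ADT.IncludesArrangement L) :
    ∃ φ' : ADT.Formula S.sig, φ'.IsQF ∧
      (S.datatypes : ADT.Theory.{u} S.sig).Equivalent
        (ADT.Formula.conj L) (ADT.Formula.exNew (ADT.Formula.conj L) φ') ∧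
      (S.treeStar : ADT.Theory.{u} S.sig).Equivalent
        (ADT.Formula.conj L) (ADT.Formula.exNew (ADT.Formula.conj L) φ') ∧
      ((S.datatypes : ADT.Theory.{u} S.sig).Satisfiable φ' ↔
        (S.tree : ADT.Theory.{u} S.sig).Satisfiable φ') := by
  classical
  obtain ⟨N, hN⟩ := S.exists_height_bound
  let ψ : ADT.Formula S.sig := .conj ((ADT.Formula.conj L).fv.toList.map fun x =>
    S.unfoldFormula (N + 1) x.1 (ADT.Term.var (Sg := S.sig) x.1 x.2))
  have hψ : ∀ {A : ADT.Structure.{u} S.sig}, S.IsTreeStar A → ∀ v : A.Valuation, ψ.Sat A v := by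
    intro A hA v
    refine ADT.Formula.sat_conj.2 fun χ hχ => ?_
    obtain ⟨x, -, rfl⟩ := List.mem_map.1 hχ
    exact S.sat_unfoldFormula hA v _ _
  have hfv : (ADT.Formula.and (ADT.Formula.conj L) ψ).fv ⊆ (ADT.Formula.conj L).fv := by
    refine Finset.union_subset (Finset.Subset.refl _) (ADT.Formula.fv_conj_subset fun χ hχ => ?_)
    obtain ⟨x, hx, rfl⟩ := List.mem_map.1 hχ
    refine (S.fv_unfoldFormula _ _ _).trans ?_
    rw [ADT.Term.fv, Finset.singleton_subset_iff]
    exact Finset.mem_toList.1 hx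
  have hequiv : (S.treeStar : ADT.Theory.{u} S.sig).Equivalent (ADT.Formula.conj L)
      (ADT.Formula.exNew (ADT.Formula.conj L) (.and (ADT.Formula.conj L) ψ)) := by
    intro A hA v
    rw [ADT.Formula.exNew_eq_self hfv]
    exact ⟨fun h => ⟨h, hψ hA v⟩, fun h => h.1⟩
  refine ⟨.and (.conj L) ψ, ⟨ADT.Formula.isQF_conj fun l hl => (hflat l hl).isQF,
    ADT.Formula.isQF_conj fun χ hχ => ?_⟩, fun A hA => hequiv A (S.datatypes_subset_treeStar hA),
    hequiv, ?_, ?_⟩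
  · obtain ⟨x, -, rfl⟩ := List.mem_map.1 hχ
    exact S.isQF_unfoldFormula _ _ _
  · rintro ⟨A, hA, v, hv⟩
    exact ⟨A, S.treeStar_subset_tree (S.datatypes_subset_treeStar hA), v, hv⟩
  · rintro ⟨A, hA, v, hL, hunf⟩
    obtain ⟨B, hB, w, hw⟩ := ADT.DatatypesSignature.IsTree.satisfiable_datatypes hA hN v L hflat
      (ADT.Formula.sat_conj.1 hL) fun x hx => S.unfolds_of_sat (ADT.Formula.sat_conj.1 hunf _
        (List.mem_map.2 ⟨x, Finset.mem_toList.2 hx, rfl⟩))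
    -- The embedding transfers only the flat literals; ψ holds in the structure of trees because it
    -- is valid there.
    exact ⟨B, hB, w, hw, hψ (S.datatypes_subset_treeStar hB) w⟩
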